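/- **Setting.** For a finite connected graph $G$, let $M_G$ be the group generated by the vertices $v_j$, the directed edges $e_{jk}$ and the central phases $\pm1,\pm i$, subject to $e_{jk}^2=v_j^2=1$, $e_{jk}=-e_{kj}$, where the generators commute except that $e_{jk}$ anticommutes with $v_j$ and $v_k$, and two edges sharing exactly one vertex anticommute. Let $\mathcal C_G\le M_G$ be the group of elements $i^{n}e_{j_1j_2}e_{j_2j_3}\cdots e_{j_nj_1}$ attached to closed walks with $n$ edges. A fermionic encoding is a homomorphism $\sigma$ from $M_G$ to the Pauli group on $N$ qubits that sends phases to the same phases and satisfies $-1\notin S:=\sigma(\mathcal C_G)$. Its disparity is $\Delta=N-M-D(S)$, where $M$ is the number of vertices of $G$ and $D(S)$ is the minimal number of generators of $S$. A 6.4.3.4 lattice is a finite set of faces (hexagons, squares, triangles) of the 6.4.3.4 uniform tiling; its fermionic graph consists of the vertices and sides of these faces. It has no holes if any two faces of the tiling outside it are joined by a chain of faces outside it in which consecutive faces share a side. The encoding has one qubit for each vertex and one for each square of the lattice. Orient the sides of hexagons counterclockwise and the sides of triangles clockwise. Then $\sigma(v_j)=Z_j$, and for an edge oriented from $j$ to $k$,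 $\sigma(e_{jk})=\pm X_jY_kP_f$, where $f$ is the unique square of the tiling having the edge as a side, $P=X$ if the edge is a side of a hexagon and $P=Y$ if it is a side of a triangle, and $P_f$ is omitted if $f$ is not in the lattice. The signs are chosen so that $\sigma$ is a fermionic encoding. **Proposition.** Consider a 6.4.3.4 lattice whose fermionic graph is connected, which has no holes, in which every hexagonal face is fully surrounded (all squares and triangles of the tiling that share a vertex with it belong to the lattice), and which consists only of hexagonal faces and of the squares and triangles surrounding them. Then signs as above exist, and for every such choice of signs the disparity of the encoding is $$\Delta=-1.$$ -/

import Mathlib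

namespace FermionEncoding

/-! ## The multi-qubit Pauli group -/

/-- The four single-qubit Pauli operators. -/
inductive Pauli : Type
  | I | X | Y | Z
  deriving DecidableEq

namespace Pauli

instance : Fintype Pauli := ⟨{I, X, Y, Z}, fun p => by cases p <;> decide⟩

/-- The product of two Pauli operators, up to a phase. -/
def mulOp : Pauli → Pauli → Pauli
  | I, p => p
  | p, I => p
  | X, X => I
  | Y, Y => I
  | Z, Z => I
  | X, Y => Z
  | Y, X => Z
  | Y, Z => X
  | Z, Y => X
  | Z, X => Y
  | X, Z => Y

/-- The exponent `a` of the phase `i ^ a` in the product of two Pauli operators. -/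
def mulPhase : Pauli → Pauli → ZMod 4
  | X, Y => 1
  | Y, Z => 1
  | Z, X => 1
  | Y, X => 3
  | Z, Y => 3
  | X, Z => 3
  | _, _ => 0

/-- The Pauli matrices. -/
def toMatrix : Pauli → Matrix (Fin 2) (Fin 2) ℂ
  | I => !![1, 0; 0, 1]
  | X => !![0, 1; 1, 0]
  | Y => !![0, -Complex.I; Complex.I, 0]
  | Z => !![1, 0; 0, -1]

/-- The multiplication table above is the one of the Pauli matrices. -/
theorem toMatrix_mul (p q : Pauli) :
    p.toMatrix * q.toMatrix = Complex.I ^ (mulPhase p q).val • (mulOp p q).toMatrix := by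
  have h1 : (1 : ZMod 4).val = 1 := rfl
  have h3 : (3 : ZMod 4).val = 3 := rfl
  have hI : Complex.I ^ 3 = -Complex.I := by
    rw [pow_succ, Complex.I_sq]; ring
  cases p <;> cases q <;> ext a b <;> fin_cases a <;> fin_cases b <;>
    simp [toMatrix, mulPhase, mulOp, h1, h3, hI, Matrix.mul_apply, Fin.sum_univ_two]

theorem mulOp_assoc (p q r : Pauli) : mulOp (mulOp p q) r = mulOp p (mulOp q r) := by
  cases p <;> cases q <;> cases r <;> rfl

theorem mulPhase_assoc (p q r : Pauli) :
    mulPhase p q + mulPhase (mulOp p q) r = mulPhase q r + mulPhase p (mulOp q r) := by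
  cases p <;> cases q <;> cases r <;> rfl

end Pauli

/-- The Pauli group `{±1, ±i} × ∏_q {I_q, X_q, Y_q, Z_q}` on the qubits `q : Q`. The element
`⟨a, p⟩` is the operator `i ^ a • ⨂_q p q`. -/
@[ext]
structure PauliGroup (Q : Type) where
  phase : ZMod 4
  op : Q → Pauli

namespace PauliGroup

variable {Q : Type}

instance [Fintype Q] : Mul (PauliGroup Q) :=
  ⟨fun a b => ⟨a.phase + b.phase + ∑ q, Pauli.mulPhase (a.op q) (b.op q),
    fun q => Pauli.mulOp (a.op q) (b.op q)⟩⟩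

instance : One (PauliGroup Q) := ⟨⟨0, fun _ => Pauli.I⟩⟩

instance : Inv (PauliGroup Q) := ⟨fun a => ⟨-a.phase, a.op⟩⟩

@[simp] theorem mul_phase [Fintype Q] (a b : PauliGroup Q) :
    (a * b).phase = a.phase + b.phase + ∑ q, Pauli.mulPhase (a.op q) (b.op q) := rfl

@[simp] theorem mul_op [Fintype Q] (a b : PauliGroup Q) (q : Q) :
    (a * b).op q = Pauli.mulOp (a.op q) (b.op q) := rfl

@[simp] theorem one_phase : (1 : PauliGroup Q).phase = 0 := rfl

@[simp] theorem one_op (q : Q) : (1 : PauliGroup Q).op q = Pauli.I := rfl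

@[simp] theorem inv_phase (a : PauliGroup Q) : (a⁻¹).phase = -a.phase := rfl

@[simp] theorem inv_op (a : PauliGroup Q) (q : Q) : (a⁻¹).op q = a.op q := rfl

instance [Fintype Q] : Group (PauliGroup Q) :=
  Group.ofLeftAxioms
    (by
      intro a b c
      apply PauliGroup.ext
      · have h : ∑ q, Pauli.mulPhase (a.op q) (b.op q) +
            ∑ q, Pauli.mulPhase (Pauli.mulOp (a.op q) (b.op q)) (c.op q) =
            ∑ q, Pauli.mulPhase (b.op q) (c.op q) +
            ∑ q, Pauli.mulPhase (a.op q) (Pauli.mulOp (b.op q) (c.op q)) := by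
          rw [← Finset.sum_add_distrib, ← Finset.sum_add_distrib]
          exact Finset.sum_congr rfl fun q _ => Pauli.mulPhase_assoc _ _ _
        simp only [mul_phase, mul_op]
        linear_combination h
      · funext q
        exact Pauli.mulOp_assoc _ _ _)
    (by
      intro a
      apply PauliGroup.ext
      · have h : ∀ p, Pauli.mulPhase Pauli.I p = 0 := by
          intro p; cases p <;> rfl
        simp [h]
      · funext q
        rfl)
    (by
      intro a
      apply PauliGroup.ext
      · have h : ∀ p, Pauli.mulPhase p p = 0 := by
          intro p; cases p <;> rfl
        simp [h]
      · funext q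
        change Pauli.mulOp (a.op q) (a.op q) = Pauli.I
        cases a.op q <;> rfl)

instance [Fintype Q] : Finite (PauliGroup Q) := by
  classical
  have : Function.Injective
      (fun a : PauliGroup Q => ((a.phase, a.op) : ZMod 4 × (Q → Pauli))) := by
    intro a b h
    exact PauliGroup.ext (congrArg Prod.fst h) (congrArg Prod.snd h)
  have : Finite (ZMod 4) := inferInstanceAs (Finite (Fin 4))
  exact Finite.of_injective _ ‹_›

/-- The scalar operator `i ^ a`; in particular `scalar 2` is `-1`. -/
def scalar (Q : Type) (a : ZMod 4) : PauliGroup Q := ⟨a, fun _ => Pauli.I⟩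

end PauliGroup

/-! ## The group of a fermionic graph, encodings and their disparity -/

section Graph

variable {V : Type} (G : SimpleGraph V)

/-- The generators of `M_G`: the vertices, the directed edges and the phases `i ^ a`. -/
inductive Generator : Type
  | vertex (v : V)
  | edge (d : G.Dart)
  | phase (a : ZMod 4)

/-- The relators of `M_G`. An equation `x = y` is given by the relator `x * y⁻¹`; `phase 2` is
`-1`, so that `x y = - y x` reads `x * y * (phase 2 * y * x)⁻¹`. -/
inductive Relator : FreeGroup (Generator G) → Prop
  | phase_mul (a b : ZMod 4) :
      Relator (.of (.phase a) * .of (.phase b) * (.of (.phase (a + b)))⁻¹)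
  | phase_central (a : ZMod 4) (g : Generator G) :
      Relator (.of (.phase a) * .of g * (.of g * .of (.phase a))⁻¹)
  | edge_sq (d : G.Dart) : Relator (.of (.edge d) * .of (.edge d))
  | vertex_sq (v : V) : Relator (.of (.vertex v) * .of (.vertex v))
  | edge_symm (d : G.Dart) :
      Relator (.of (.edge d) * (.of (.phase 2) * .of (.edge d.symm))⁻¹)
  | vertex_vertex (i j : V) :
      Relator (.of (.vertex i) * .of (.vertex j) * (.of (.vertex j) * .of (.vertex i))⁻¹)
  | edge_vertex (d : G.Dart) (k : V) (h₁ : k ≠ d.fst) (h₂ : k ≠ d.snd) :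
      Relator (.of (.edge d) * .of (.vertex k) * (.of (.vertex k) * .of (.edge d))⁻¹)
  | edge_edge (d d' : G.Dart) (h₁ : d.fst ≠ d'.fst) (h₂ : d.fst ≠ d'.snd)
      (h₃ : d.snd ≠ d'.fst) (h₄ : d.snd ≠ d'.snd) :
      Relator (.of (.edge d) * .of (.edge d') * (.of (.edge d') * .of (.edge d))⁻¹)
  | edge_vertex_anti (d : G.Dart) :
      Relator (.of (.edge d) * .of (.vertex d.snd) *
        (.of (.phase 2) * .of (.vertex d.snd) * .of (.edge d))⁻¹)
  | edge_edge_anti (d d' : G.Dart) (h₁ : d.snd = d'.fst) (h₂ : d.fst ≠ d'.snd) :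
      Relator (.of (.edge d) * .of (.edge d') *
        (.of (.phase 2) * .of (.edge d') * .of (.edge d))⁻¹)

/-- The finitely presented group `M_G`. -/
abbrev MG : Type := PresentedGroup {w | Relator G w}

/-- The element of `M_G` given by a generator. -/
def MG.gen (g : Generator G) : MG G := PresentedGroup.of g

/-- The element `i ^ n e_{i_1 i_2} e_{i_2 i_3} ⋯ e_{i_n i_1}` of `M_G` attached to a closed walk
with `n` edges. -/
def cycleElement {v : V} (p : G.Walk v v) : MG G :=
  MG.gen G (.phase (p.length : ZMod 4)) * (p.darts.map fun d => MG.gen G (.edge d)).prod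

/-- The group of directed cycles `C_G`. -/
def cycleGroup : Subgroup (MG G) :=
  Subgroup.closure {c | ∃ (v : V) (p : G.Walk v v), c = cycleElement G p}

variable {G} {Q : Type} [Fintype Q]

/-- The group `S = σ(C_G)`. -/
def stabilizerGroup (σ : MG G →* PauliGroup Q) : Subgroup (PauliGroup Q) :=
  (cycleGroup G).map σ

/-- A representation of `M_G` by Pauli operators (phases acting as phases) is a fermionic encoding
if no element of `C_G` is mapped to `-1`. -/
structure IsEncoding (σ : MG G →* PauliGroup Q) : Prop where
  phase : ∀ a, σ (MG.gen G (.phase a)) = PauliGroup.scalar Q a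
  neg_one_notMem : PauliGroup.scalar Q 2 ∉ stabilizerGroup σ

/-- The disparity `Δ = N - M - D(S)`: the number of qubits, minus the number of modes, minus the
minimal number of generators of `S`. -/
noncomputable def disparity [Fintype V] (σ : MG G →* PauliGroup Q) : ℤ :=
  (Fintype.card Q : ℤ) - (Fintype.card V : ℤ) - (Group.rank (stabilizerGroup σ) : ℤ)

end Graph

/-! ## The 6.4.3.4 tiling

The hexagons are indexed by `ℤ × ℤ`, the hexagon `(a, b)` being the one with unit sides and
centre `(1 + √3) (a e^{iπ/6} + b e^{iπ/2})` in the complex plane. Its neighbour across the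
square in direction `π/6 + jπ/3` is `(a, b) + dir j`, for `j` modulo 6. Every vertex of the tiling
lies on exactly one hexagon; the vertex `(x, k)` is the corner of the hexagon `x` in direction
`(k + 1)π/3` from its centre, that is, between the directions of `dir k` and `dir (k + 1)`. -/

/-- The vertices of the tiling. -/
abbrev Vertex : Type := (ℤ × ℤ) × ZMod 6

/-- The displacements between neighbouring hexagons, in counterclockwise order. -/
def dir (j : ZMod 6) : ℤ × ℤ :=
  if j = 0 then (1, 0) else if j = 1 then (0, 1) else if j = 2 then (-1, 1)
  else if j = 3 then (-1, 0) else if j = 4 then (0, -1) else (1, -1)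

/-- The head of the arrow that starts at `v` and runs counterclockwise along a hexagon. -/
def hexNext (v : Vertex) : Vertex := (v.1, v.2 + 1)

/-- The head of the arrow that starts at `v` and runs clockwise along a triangle. -/
def triNext (v : Vertex) : Vertex := (v.1 + dir (v.2 + 1), v.2 + 4)

/-- The graph of the 6.4.3.4 tiling: every edge is a side of a unique hexagon or of a unique
triangle. -/
def tiling : SimpleGraph Vertex :=
  SimpleGraph.fromRel fun u w => w = hexNext u ∨ w = triNext u

/-- The hexagon `x`; a face is given by the set of its vertices. -/
def hexagon (x : ℤ × ℤ) : Finset Vertex := Finset.univ.image fun k : ZMod 6 => (x, k)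

/-- The square between the hexagons `x` and `x + dir j`. -/
def square (x : ℤ × ℤ) (j : ZMod 6) : Finset Vertex :=
  {(x, j - 1), (x, j), (x + dir j, j + 2), (x + dir j, j + 3)}

/-- The triangle between the hexagons `x`, `x + dir k` and `x + dir (k + 1)`. -/
def triangle (x : ℤ × ℤ) (k : ZMod 6) : Finset Vertex :=
  {(x, k), (x + dir k, k + 2), (x + dir (k + 1), k + 4)}

def IsHexagon (f : Finset Vertex) : Prop := ∃ x, f = hexagon x

def IsSquare (f : Finset Vertex) : Prop := ∃ x j, f = square x j

def IsTriangle (f : Finset Vertex) : Prop := ∃ x k, f = triangle x k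

/-- The (bounded) faces of the tiling. -/
def IsFace (f : Finset Vertex) : Prop := IsHexagon f ∨ IsSquare f ∨ IsTriangle f

/-- Two different faces are adjacent if they have a common side. -/
def faceAdjacency : SimpleGraph (Finset Vertex) :=
  SimpleGraph.fromRel fun f g => ∃ u w, tiling.Adj u w ∧ u ∈ f ∧ w ∈ f ∧ u ∈ g ∧ w ∈ g

/-! ## Finite 6.4.3.4 lattices

A finite lattice is given by the finite set `F` of its faces. -/

/-- The vertices of the lattice: those of its faces. -/
abbrev LatticeVertex (F : Finset (Finset Vertex)) : Type := {v : Vertex // v ∈ F.biUnion id}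

/-- The fermionic graph of the lattice: its edges are the sides of its faces. -/
def latticeGraph (F : Finset (Finset Vertex)) : SimpleGraph (LatticeVertex F) where
  Adj u w := tiling.Adj u.1 w.1 ∧ ∃ f ∈ F, u.1 ∈ f ∧ w.1 ∈ f
  symm := ⟨fun _ _ ⟨h, f, hf, hu, hw⟩ => ⟨h.symm, f, hf, hw, hu⟩⟩
  loopless := ⟨fun _ ⟨h, _⟩ => h.ne rfl⟩

/-- Every hexagon of the lattice is fully surrounded: the squares and triangles around it (the
faces of the tiling that share a vertex with it) belong to the lattice. -/
def HexagonsSurrounded (F : Finset (Finset Vertex)) : Prop :=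
  ∀ h ∈ F, IsHexagon h → ∀ f, IsFace f → (f ∩ h).Nonempty → f ∈ F

/-- The lattice consists only of hexagons and of faces that surround its hexagons. -/
def MadeOfHexagons (F : Finset (Finset Vertex)) : Prop :=
  ∀ f ∈ F, ∃ h ∈ F, IsHexagon h ∧ (f ∩ h).Nonempty

/-- The lattice has no holes: the region that it leaves uncovered is connected, that is, any two
faces outside it are joined by a chain of faces outside it, each adjacent to the next. -/
def NoHoles (F : Finset (Finset Vertex)) : Prop :=
  (faceAdjacency.induce {f | IsFace f ∧ f ∉ F}).Preconnected

/-! ## The encoding -/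

/-- The qubits: one for every vertex, and one for every square face of the lattice. -/
abbrev Qubit (F : Finset (Finset Vertex)) : Type :=
  LatticeVertex F ⊕ {f : F // IsSquare f.1}

noncomputable instance (F : Finset (Finset Vertex)) : Fintype {f : F // IsSquare f.1} :=
  Fintype.ofFinite _

open Classical in
/-- The Pauli string `Z_v`. -/
noncomputable def vertexString (F : Finset (Finset Vertex)) (v : LatticeVertex F) :
    Qubit F → Pauli
  | .inl u => if u = v then .Z else .I
  | .inr _ => .I

open Classical in
/-- The Pauli string `X_u Y_w P_f` of an arrow from `u` to `w`, where `f` is the square that has the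
edge as a side. Both arrows that start at `u` are sides of the square between the hexagon of `u` and
its neighbour in direction `u.2 + 1`. If that square is not in the lattice, `P_f` is omitted. -/
noncomputable def edgeString (F : Finset (Finset Vertex)) (u w : LatticeVertex F) (P : Pauli) :
    Qubit F → Pauli
  | .inl v => if v = u then .X else if v = w then .Y else .I
  | .inr f => if f.1.1 = square u.1.1 (u.1.2 + 1) then P else .I

/-- The encoding of the 6.4.3.4 lattice: vertex operators are `Z_v`; edges along hexagons are
oriented counterclockwise and act on the qubit of their square by `X`; edges along triangles are
oriented clockwise and act on the qubit of their square by `Y`. The signs of the edge operators are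
arbitrary as long as the result is an encoding. -/
structure IsLatticeEncoding (F : Finset (Finset Vertex))
    (σ : MG (latticeGraph F) →* PauliGroup (Qubit F)) : Prop where
  isEncoding : IsEncoding σ
  vertex : ∀ v, σ (MG.gen _ (.vertex v)) = ⟨0, vertexString F v⟩
  hexEdge : ∀ d : (latticeGraph F).Dart, d.snd.1 = hexNext d.fst.1 →
    ∃ s : ZMod 4, (s = 0 ∨ s = 2) ∧
      σ (MG.gen _ (.edge d)) = ⟨s, edgeString F d.fst d.snd .X⟩
  triEdge : ∀ d : (latticeGraph F).Dart, d.snd.1 = triNext d.fst.1 →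
    ∃ s : ZMod 4, (s = 0 ∨ s = 2) ∧
      σ (MG.gen _ (.edge d)) = ⟨s, edgeString F d.fst d.snd .Y⟩

end FermionEncoding

open FermionEncoding

/-! The vertex qubits cancel against the modes, so with `s` the number of squares the disparity is
`s - D(S)`, and the claim is `D(S) = s + 1`.

Rank. An encoding has no scalar other than `1` in `S`: `-1` is excluded, and `±i` would square to
it. So `S` embeds into the bit vectors of Pauli strings, and its rank is the dimension of the image
of the mod 2 cycle space under the linear map `stringMap` (`rank_eq_finrank`,
`mem_map_cycleSpace_iff`). Every lattice vertex is the tail of one triangle arrow, and every square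
contains two hexagon arrows, so there are `|V| + 2s` edges and the cycle space of the connected
graph has dimension `2s + 1`. In a chain killed by `stringMap` the arrows into each vertex, and
those out of it, cancel mod 2. Both arrows out of a vertex lie in one square, as do both arrows into
it; hence the coefficients are constant around each square, and the kernel is spanned by the `s`
square boundaries (`ker_stringMap`), which are cycles. This leaves `2s + 1 - s = s + 1`.

Existence. The strings satisfy the commutation relations: arrows meeting head to tail anticommute at
the common vertex, while arrows with a common head or tail commute there and anticommute on the
qubit of their square (`form_operator`). A minus sign on one hexagon arrow per square sends every
square walk to `1`. To exclude `-1` from `S`, let `σ c` be a scalar with `c` in the cycle group.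
Modulo `±1` the group `M_G` is abelian, so the class of `c` depends only on its mod 2 chain, which
is a sum of squares. Thus `c` agrees up to sign with a product `c'` of square cycles, and `σ c' =
1`. The Jordan–Wigner representation kills all cycle elements but not `-1`, so the sign is trivial
and `σ c = 1`. -/

namespace FermionEncoding

/-! ### Bits and symplectic form of Pauli operators -/

/-- The doubling map `ℤ/2 → ℤ/4`. -/
def double : ZMod 2 →+ ZMod 4 where
  toFun x := if x = 0 then 0 else 2
  map_zero' := rfl
  map_add' := by decide

namespace Pauli

/-- Whether a Pauli operator contains a factor `X`. -/
def xBit : Pauli → ZMod 2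
  | I => 0
  | X => 1
  | Y => 1
  | Z => 0

/-- Whether a Pauli operator contains a factor `Z`. -/
def zBit : Pauli → ZMod 2
  | I => 0
  | X => 0
  | Y => 1
  | Z => 1

theorem xBit_mulOp (p q : Pauli) : (mulOp p q).xBit = p.xBit + q.xBit := by
  cases p <;> cases q <;> rfl

theorem zBit_mulOp (p q : Pauli) : (mulOp p q).zBit = p.zBit + q.zBit := by
  cases p <;> cases q <;> rfl

theorem mulPhase_swap (p q : Pauli) :
    mulPhase p q = mulPhase q p + double (p.xBit * q.zBit + p.zBit * q.xBit) := by
  cases p <;> cases q <;> rfl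

theorem mulOp_comm (p q : Pauli) : mulOp p q = mulOp q p := by
  cases p <;> cases q <;> rfl

theorem mulOp_self (p : Pauli) : mulOp p p = I := by cases p <;> rfl

theorem mulPhase_self (p : Pauli) : mulPhase p p = 0 := by cases p <;> rfl

@[simp] theorem mulPhase_I_left (p : Pauli) : mulPhase I p = 0 := by cases p <;> rfl

@[simp] theorem mulPhase_I_right (p : Pauli) : mulPhase p I = 0 := by cases p <;> rfl

@[simp] theorem mulOp_I_left (p : Pauli) : mulOp I p = p := by cases p <;> rfl

@[simp] theorem mulOp_I_right (p : Pauli) : mulOp p I = p := by cases p <;> rfl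

theorem eq_I_of_bits {p : Pauli} (hx : p.xBit = 0) (hz : p.zBit = 0) : p = I := by
  cases p <;> simp_all [xBit, zBit]

end Pauli

namespace PauliGroup

variable {Q : Type}

/-- The bits of a Pauli string: its `X`-part and its `Z`-part at every qubit. -/
def bitsFun (s : Q → Pauli) : Q → ZMod 2 × ZMod 2 := fun q => ((s q).xBit, (s q).zBit)

variable [Fintype Q]

/-- The homomorphism from the Pauli group to its bit vectors, with the phases as kernel. -/
def bits : PauliGroup Q →* Multiplicative (Q → ZMod 2 × ZMod 2) where
  toFun a := Multiplicative.ofAdd (bitsFun a.op)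
  map_one' := rfl
  map_mul' a b := by
    apply Multiplicative.toAdd.injective
    funext q
    exact Prod.ext (Pauli.xBit_mulOp _ _) (Pauli.zBit_mulOp _ _)

theorem eq_scalar_of_bits {a : PauliGroup Q} (h : a.bits = 1) : a = scalar Q a.phase := by
  refine PauliGroup.ext rfl (funext fun q => ?_)
  have hq : bitsFun a.op q = 0 := congrFun (congrArg Multiplicative.toAdd h) q
  exact Pauli.eq_I_of_bits (congrArg Prod.fst hq) (congrArg Prod.snd hq)

/-- The symplectic form: `1` if two Pauli operators anticommute, and `0` if they commute. -/
def form (a b : PauliGroup Q) : ZMod 2 :=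
  ∑ q, ((a.op q).xBit * (b.op q).zBit + (a.op q).zBit * (b.op q).xBit)

theorem scalar_mul (c : ZMod 4) (a : PauliGroup Q) : scalar Q c * a = ⟨c + a.phase, a.op⟩ := by
  apply PauliGroup.ext
  · simp [scalar]
  · funext q
    simp [scalar]

theorem mul_scalar (c : ZMod 4) (a : PauliGroup Q) : a * scalar Q c = ⟨c + a.phase, a.op⟩ := by
  apply PauliGroup.ext
  · simp [scalar, add_comm]
  · funext q
    simp [scalar]

theorem scalar_comm (c : ZMod 4) (a : PauliGroup Q) : scalar Q c * a = a * scalar Q c := by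
  rw [scalar_mul, mul_scalar]

theorem scalar_mul_scalar (c d : ZMod 4) : scalar Q c * scalar Q d = scalar Q (c + d) := by
  rw [scalar_mul]; rfl

theorem mul_eq_form (a b : PauliGroup Q) : a * b = scalar Q (double (form a b)) * (b * a) := by
  rw [scalar_mul]
  apply PauliGroup.ext
  · simp only [mul_phase, form, map_sum]
    rw [Finset.sum_congr rfl fun q _ => Pauli.mulPhase_swap (a.op q) (b.op q),
      Finset.sum_add_distrib]
    ring
  · funext q
    exact Pauli.mulOp_comm _ _

theorem mul_eq_of_form_zero {a b : PauliGroup Q} (h : form a b = 0) : a * b = b * a := by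
  rw [mul_eq_form, h]; exact one_mul _

theorem mul_eq_of_form_one {a b : PauliGroup Q} (h : form a b = 1) :
    a * b = scalar Q 2 * b * a := by
  rw [mul_eq_form, h, mul_assoc]; rfl

theorem form_mul_left (a b c : PauliGroup Q) : form (a * b) c = form a c + form b c := by
  simp only [form, mul_op, Pauli.xBit_mulOp, Pauli.zBit_mulOp, ← Finset.sum_add_distrib]
  exact Finset.sum_congr rfl fun q _ => by ring

theorem form_mul_right (a b c : PauliGroup Q) : form a (b * c) = form a b + form a c := by
  simp only [form, mul_op, Pauli.xBit_mulOp, Pauli.zBit_mulOp, ← Finset.sum_add_distrib]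
  exact Finset.sum_congr rfl fun q _ => by ring

theorem form_comm (a b : PauliGroup Q) : form a b = form b a :=
  Finset.sum_congr rfl fun q _ => by ring

@[simp] theorem form_scalar_left (c : ZMod 4) (a : PauliGroup Q) : form (scalar Q c) a = 0 := by
  simp [form, scalar, Pauli.xBit, Pauli.zBit]

@[simp] theorem form_scalar_right (c : ZMod 4) (a : PauliGroup Q) : form a (scalar Q c) = 0 := by
  rw [form_comm, form_scalar_left]

theorem mul_self_eq (a : PauliGroup Q) : a * a = scalar Q (2 * a.phase) := by
  apply PauliGroup.ext
  · simp only [mul_phase, Pauli.mulPhase_self, Finset.sum_const_zero, scalar]; ring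
  · funext q
    exact Pauli.mulOp_self _

end PauliGroup

/-! ### The presented group and its abelian quotient by signs -/

section Presentation

variable {V : Type} {G : SimpleGraph V} {Q : Type} [Fintype Q]

open PauliGroup Classical in
/-- A choice of Pauli operators with the commutation relations of `M_G` is a representation. -/
theorem exists_representation (v : V → PauliGroup Q) (e : G.Dart → PauliGroup Q)
    (hv : ∀ i, v i * v i = 1) (he : ∀ d, e d * e d = 1)
    (hsymm : ∀ d, e d = scalar Q 2 * e d.symm) (hvv : ∀ i j, form (v i) (v j) = 0)
    (hev : ∀ (d : G.Dart) k,
      form (e d) (v k) = (if k = d.fst then 1 else 0) + if k = d.snd then 1 else 0)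
    (hee : ∀ d d' : G.Dart, d.fst ≠ d'.fst → d.fst ≠ d'.snd → d.snd ≠ d'.fst → d.snd ≠ d'.snd →
      form (e d) (e d') = 0)
    (hee' : ∀ d d' : G.Dart, d.snd = d'.fst → d.fst ≠ d'.snd → form (e d) (e d') = 1) :
    ∃ σ : MG G →* PauliGroup Q, (∀ a, σ (MG.gen G (.phase a)) = scalar Q a) ∧
      (∀ i, σ (MG.gen G (.vertex i)) = v i) ∧ ∀ d, σ (MG.gen G (.edge d)) = e d := by
  let f : Generator G → PauliGroup Q
    | .vertex i => v i
    | .edge d => e d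
    | .phase a => scalar Q a
  have hf : ∀ r ∈ {w | Relator G w}, FreeGroup.lift f r = 1 := by
    rintro r (⟨a, b⟩ | ⟨a, g⟩ | d | i | d | ⟨i, j⟩ | ⟨d, k, h₁, h₂⟩ | ⟨d, d', h₁, h₂, h₃, h₄⟩ | d |
      ⟨d, d', h₁, h₂⟩)
    · simp only [map_mul, map_inv, FreeGroup.lift_apply_of, mul_inv_eq_one]
      exact scalar_mul_scalar a b
    · simp only [map_mul, map_inv, FreeGroup.lift_apply_of, mul_inv_eq_one]
      exact scalar_comm a _
    · simp only [map_mul, FreeGroup.lift_apply_of]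
      exact he d
    · simp only [map_mul, FreeGroup.lift_apply_of]
      exact hv i
    · simp only [map_mul, map_inv, FreeGroup.lift_apply_of, mul_inv_eq_one]
      exact hsymm d
    · simp only [map_mul, map_inv, FreeGroup.lift_apply_of, mul_inv_eq_one]
      exact mul_eq_of_form_zero (hvv i j)
    · simp only [map_mul, map_inv, FreeGroup.lift_apply_of, mul_inv_eq_one]
      exact mul_eq_of_form_zero (by rw [hev, if_neg h₁, if_neg h₂, add_zero])
    · simp only [map_mul, map_inv, FreeGroup.lift_apply_of, mul_inv_eq_one]
      exact mul_eq_of_form_zero (hee d d' h₁ h₂ h₃ h₄)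
    · simp only [map_mul, map_inv, FreeGroup.lift_apply_of, mul_inv_eq_one]
      exact mul_eq_of_form_one (by rw [hev, if_neg d.snd_ne_fst, if_pos rfl, zero_add])
    · simp only [map_mul, map_inv, FreeGroup.lift_apply_of, mul_inv_eq_one]
      exact mul_eq_of_form_one (hee' d d' h₁ h₂)
  exact ⟨PresentedGroup.toGroup hf, fun a => PresentedGroup.toGroup.of hf,
    fun i => PresentedGroup.toGroup.of hf, fun d => PresentedGroup.toGroup.of hf⟩

theorem relator_eq {x y : FreeGroup (Generator G)} (h : Relator G (x * y⁻¹)) :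
    PresentedGroup.mk {w | Relator G w} x = PresentedGroup.mk _ y := by
  have h1 : PresentedGroup.mk {w | Relator G w} (x * y⁻¹) = 1 := PresentedGroup.one_of_mem h
  rwa [map_mul, map_inv, mul_inv_eq_one] at h1

theorem gen_phase_mul (a b : ZMod 4) : MG.gen G (.phase a) * MG.gen G (.phase b) =
    MG.gen G (.phase (a + b)) :=
  relator_eq (Relator.phase_mul a b)

theorem gen_phase_comm (a : ZMod 4) (g : Generator G) :
    MG.gen G (.phase a) * MG.gen G g = MG.gen G g * MG.gen G (.phase a) :=
  relator_eq (Relator.phase_central a g)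

theorem gen_edge_symm (d : G.Dart) :
    MG.gen G (.edge d) = MG.gen G (.phase 2) * MG.gen G (.edge d.symm) :=
  relator_eq (Relator.edge_symm d)

theorem gen_edge_sq (d : G.Dart) : MG.gen G (.edge d) * MG.gen G (.edge d) = 1 :=
  PresentedGroup.one_of_mem (Relator.edge_sq d)

theorem gen_phase_zero : MG.gen G (.phase 0) = 1 := by
  have h := gen_phase_mul (G := G) 0 0
  rwa [add_zero, mul_eq_left] at h

theorem gen_phase_mem_center (a : ZMod 4) : MG.gen G (.phase a) ∈ Subgroup.center (MG G) := by
  have h : (⊤ : Subgroup (MG G)) ≤ Subgroup.centralizer {MG.gen G (.phase a)} := by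
    rw [← PresentedGroup.closure_range_of, Subgroup.closure_le]
    rintro _ ⟨g, rfl⟩
    exact Subgroup.mem_centralizer_singleton_iff.2 (gen_phase_comm a g).symm
  exact Subgroup.mem_center_iff.2 fun g =>
    Subgroup.mem_centralizer_singleton_iff.1 (h (Subgroup.mem_top g))

variable (G) in
/-- The subgroup `{±1}` of `M_G`. -/
def signs : Subgroup (MG G) := Subgroup.zpowers (MG.gen G (.phase 2))

instance : (signs G).Normal :=
  ⟨fun n hn g => by
    have hc : n ∈ Subgroup.center (MG G) :=
      Subgroup.zpowers_le.2 (gen_phase_mem_center 2) hn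
    rw [Subgroup.mem_center_iff.1 hc g, mul_inv_cancel_right]
    exact hn⟩

theorem mem_signs {m : MG G} (hm : m ∈ signs G) : m = 1 ∨ m = MG.gen G (.phase 2) := by
  obtain ⟨n, rfl⟩ := Subgroup.mem_zpowers_iff.1 hm
  have hz : MG.gen G (.phase 2) ^ (2 : ℤ) = 1 := by
    rw [zpow_ofNat, pow_two, gen_phase_mul]
    exact gen_phase_zero
  rcases Int.even_or_odd' n with ⟨k, rfl | rfl⟩
  · left; rw [zpow_mul, hz, one_zpow]
  · right; rw [zpow_add, zpow_mul, hz, one_zpow, one_mul, zpow_one]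

theorem mk_phase_two : (QuotientGroup.mk (MG.gen G (.phase 2)) : MG G ⧸ signs G) = 1 :=
  (QuotientGroup.eq_one_iff _).2 (Subgroup.mem_zpowers _)

theorem mk_edge_symm (d : G.Dart) : (QuotientGroup.mk (MG.gen G (.edge d.symm)) : MG G ⧸ signs G) =
    QuotientGroup.mk (MG.gen G (.edge d)) := by
  rw [gen_edge_symm d, QuotientGroup.mk_mul, mk_phase_two, one_mul]

/-- The relators treat only the head of a dart; the tail is reached by reversing the dart, which
costs a sign that vanishes in the quotient. -/
theorem mk_edge_vertex_comm (d : G.Dart) (k : V) :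
    Commute (QuotientGroup.mk (MG.gen G (.edge d)) : MG G ⧸ signs G)
      (QuotientGroup.mk (MG.gen G (.vertex k))) := by
  have key : ∀ d : G.Dart, Commute (QuotientGroup.mk (MG.gen G (.edge d)) : MG G ⧸ signs G)
      (QuotientGroup.mk (MG.gen G (.vertex d.snd))) := by
    intro d
    have h : MG.gen G (.edge d) * MG.gen G (.vertex d.snd) =
        MG.gen G (.phase 2) * MG.gen G (.vertex d.snd) * MG.gen G (.edge d) :=
      relator_eq (Relator.edge_vertex_anti d)
    have h' := congrArg (QuotientGroup.mk : _ → MG G ⧸ signs G) h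
    rwa [QuotientGroup.mk_mul, QuotientGroup.mk_mul, QuotientGroup.mk_mul, mk_phase_two,
      one_mul] at h'
  by_cases h₁ : k = d.fst
  · rw [← mk_edge_symm, h₁]
    exact key d.symm
  by_cases h₂ : k = d.snd
  · rw [h₂]
    exact key d
  · exact congrArg (QuotientGroup.mk : _ → MG G ⧸ signs G)
      (relator_eq (Relator.edge_vertex d k h₁ h₂))

/-- Modulo signs a dart equals its reverse, so every way of sharing an endpoint reduces to the
head-to-tail case covered by the relators. -/
theorem mk_edge_edge_comm (d d' : G.Dart) :
    Commute (QuotientGroup.mk (MG.gen G (.edge d)) : MG G ⧸ signs G)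
      (QuotientGroup.mk (MG.gen G (.edge d'))) := by
  have key : ∀ d d' : G.Dart, d.snd = d'.fst →
      Commute (QuotientGroup.mk (MG.gen G (.edge d)) : MG G ⧸ signs G)
        (QuotientGroup.mk (MG.gen G (.edge d'))) := by
    intro d d' h₁
    by_cases h₂ : d.fst = d'.snd
    · have : d' = d.symm := SimpleGraph.Dart.ext _ _ (Prod.ext h₁.symm h₂.symm)
      rw [this, mk_edge_symm]
    · have h : MG.gen G (.edge d) * MG.gen G (.edge d') =
          MG.gen G (.phase 2) * MG.gen G (.edge d') * MG.gen G (.edge d) :=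
        relator_eq (Relator.edge_edge_anti d d' h₁ h₂)
      have h' := congrArg (QuotientGroup.mk : _ → MG G ⧸ signs G) h
      rwa [QuotientGroup.mk_mul, QuotientGroup.mk_mul, QuotientGroup.mk_mul, mk_phase_two,
        one_mul] at h'
  by_cases h₁ : d.fst = d'.fst
  · rw [← mk_edge_symm d]
    exact key _ _ h₁
  by_cases h₂ : d.fst = d'.snd
  · exact (key _ _ h₂.symm).symm
  by_cases h₃ : d.snd = d'.fst
  · exact key _ _ h₃
  by_cases h₄ : d.snd = d'.snd
  · rw [← mk_edge_symm d']
    exact key _ _ h₄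
  · exact congrArg (QuotientGroup.mk : _ → MG G ⧸ signs G)
      (relator_eq (Relator.edge_edge d d' h₁ h₂ h₃ h₄))

/-- All generators commute or anticommute. Commutativity is what allows unordered products over the
edges of a chain. -/
theorem quotient_signs_comm (a b : MG G ⧸ signs G) : a * b = b * a := by
  have hgen : ∀ g g' : Generator G, Commute (QuotientGroup.mk (MG.gen G g) : MG G ⧸ signs G)
      (QuotientGroup.mk (MG.gen G g')) := by
    have hphase : ∀ a g', Commute (QuotientGroup.mk (MG.gen G (.phase a)) : MG G ⧸ signs G)
        (QuotientGroup.mk (MG.gen G g')) := fun a g' =>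
      congrArg (QuotientGroup.mk : _ → MG G ⧸ signs G) (gen_phase_comm a g')
    rintro (i | d | a) (j | d' | b)
    · exact congrArg (QuotientGroup.mk : _ → MG G ⧸ signs G)
        (relator_eq (Relator.vertex_vertex i j))
    · exact (mk_edge_vertex_comm d' i).symm
    · exact (hphase b _).symm
    · exact mk_edge_vertex_comm d j
    · exact mk_edge_edge_comm d d'
    · exact (hphase b _).symm
    all_goals exact hphase a _
  have hcomm : ∀ m n : MG G, Commute (QuotientGroup.mk m : MG G ⧸ signs G) (QuotientGroup.mk n) := by
    intro m n
    have hm : m ∈ Subgroup.closure (Set.range (PresentedGroup.of (rels := {w | Relator G w}))) := by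
      rw [PresentedGroup.closure_range_of]; trivial
    have hn : n ∈ Subgroup.closure (Set.range (PresentedGroup.of (rels := {w | Relator G w}))) := by
      rw [PresentedGroup.closure_range_of]; trivial
    induction hm using Subgroup.closure_induction with
    | mem x hx =>
      obtain ⟨g, rfl⟩ := hx
      induction hn using Subgroup.closure_induction with
      | mem y hy => obtain ⟨g', rfl⟩ := hy; exact hgen g g'
      | one => exact Commute.one_right _
      | mul y y' _ _ h h' => exact h.mul_right h'
      | inv y _ h => exact h.inv_right
    | one => exact Commute.one_left _
    | mul y y' _ _ h h' => exact h.mul_left h'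
    | inv y _ h => exact h.inv_left
  induction a using QuotientGroup.induction_on with | _ m =>
  induction b using QuotientGroup.induction_on with | _ n =>
  exact hcomm m n

noncomputable instance : CommGroup (MG G ⧸ signs G) :=
  { QuotientGroup.Quotient.group (signs G) with mul_comm := quotient_signs_comm }

end Presentation

end FermionEncoding

/-! ### Ranks of elementary abelian 2-groups and mod 2 graph homology -/

namespace FermionEncoding

/-- The rank of a group that embeds into a vector space over the field with two elements is the
dimension of its image. -/
theorem rank_eq_finrank {Γ M : Type*} [Group Γ] [AddCommGroup M] [Module (ZMod 2) M]
    [FiniteDimensional (ZMod 2) M] (S : Subgroup Γ) [Group.FG S] (L : Γ →* Multiplicative M)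
    (hinj : ∀ a ∈ S, L a = 1 → a = 1) (W : Submodule (ZMod 2) M)
    (hW : ∀ m, m ∈ W ↔ ∃ a ∈ S, (L a).toAdd = m) :
    Group.rank S = Module.finrank (ZMod 2) W := by
  classical
  have hinj' : ∀ a b : S, (L a).toAdd = (L b).toAdd → a = b := by
    intro a b h
    have h1 : L ((a * b⁻¹ : S) : Γ) = 1 := by
      have h2 : L a = L b := h
      simp [h2]
    have h2 := hinj _ (a * b⁻¹).2 h1
    exact mul_inv_eq_one.1 (Subtype.ext h2)
  apply le_antisymm
  -- Preimages of a basis generate: the only scalars are `0` and `1`, so linear spans are reached by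
  -- products, and injectivity lifts equality back to `S`.
  · let b := Module.finBasis (ZMod 2) W
    choose s hsS hs using fun i => (hW (b i)).1 (b i).2
    let t : Finset S := Finset.univ.image fun i => ⟨s i, hsS i⟩
    have key : ∀ w ∈ Submodule.span (ZMod 2) (Set.range b),
        ∃ a ∈ Subgroup.closure (t : Set S), (L a).toAdd = (w : M) := by
      intro w hw
      induction hw using Submodule.span_induction with
      | mem x hx =>
        obtain ⟨i, rfl⟩ := hx
        exact ⟨⟨s i, hsS i⟩, Subgroup.subset_closure (by simp [t]), hs i⟩
      | zero => exact ⟨1, one_mem _, by simp⟩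
      | add x y _ _ hx hy =>
        obtain ⟨a, ha, hx⟩ := hx
        obtain ⟨c, hc, hy⟩ := hy
        exact ⟨a * c, mul_mem ha hc, by simp [hx, hy]⟩
      | smul r x _ hx =>
        obtain ⟨a, ha, hx⟩ := hx
        rcases (by decide : ∀ r : ZMod 2, r = 0 ∨ r = 1) r with rfl | rfl
        · exact ⟨1, one_mem _, by simp⟩
        · exact ⟨a, ha, by simp [hx]⟩
    have ht : Subgroup.closure (t : Set S) = ⊤ := by
      rw [eq_top_iff]
      rintro a -
      obtain ⟨c, hc, h⟩ := key ⟨_, (hW _).2 ⟨a, a.2, rfl⟩⟩ (by rw [b.span_eq]; trivial)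
      rwa [← hinj' c a h]
    refine (Group.rank_le ht).trans (Finset.card_image_le.trans ?_)
    simp
  -- Conversely, the images of a minimal generating set span `W`.
  · obtain ⟨t, ht, hcl⟩ := Group.rank_spec S
    have key : W ≤ Submodule.span (ZMod 2) (t.image fun a : S => (L a).toAdd : Finset M) := by
      intro m hm
      obtain ⟨a, ha, rfl⟩ := (hW m).1 hm
      have hmem : (⟨a, ha⟩ : S) ∈ Subgroup.closure (t : Set S) := by rw [hcl]; trivial
      suffices ∀ x ∈ Subgroup.closure (t : Set S), (L x).toAdd ∈
          Submodule.span (ZMod 2) (t.image fun a : S => (L a).toAdd : Finset M) from this _ hmem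
      intro x hx
      induction hx using Subgroup.closure_induction with
      | mem x hx => exact Submodule.subset_span (Finset.mem_coe.2 (Finset.mem_image_of_mem _ hx))
      | one => simp
      | mul x y _ _ hx hy => simpa using add_mem hx hy
      | inv x _ hx => simpa using hx
    rw [← ht]
    exact (Submodule.finrank_mono key).trans ((finrank_span_finset_le_card _).trans
      Finset.card_image_le)

/-- A choice of a direction for every edge of a graph, the edges being labelled by `A`. -/
structure Orientation {V : Type} (G : SimpleGraph V) (A : Type) where
  dart : A → G.Dart
  arrow : G.Dart → A
  arrow_dart : ∀ a, arrow (dart a) = a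
  arrow_symm : ∀ d, arrow d.symm = arrow d
  eq_or_eq_symm : ∀ d, d = dart (arrow d) ∨ d = (dart (arrow d)).symm

namespace Orientation

variable {V A : Type} [DecidableEq V] [DecidableEq A] {G : SimpleGraph V} (o : Orientation G A)

/-- The chain modulo 2 of a walk. -/
def chain {u v : V} (p : G.Walk u v) : A → ZMod 2 :=
  (p.darts.map fun d => Pi.single (o.arrow d) 1).sum

/-- The space spanned by the closed walks. -/
def cycleSpace : Submodule (ZMod 2) (A → ZMod 2) :=
  Submodule.span (ZMod 2) {x | ∃ (v : V) (p : G.Walk v v), x = o.chain p}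

variable [Fintype A]

/-- The boundary map modulo 2. -/
def boundary : (A → ZMod 2) →ₗ[ZMod 2] (V → ZMod 2) :=
  Fintype.linearCombination (ZMod 2) fun a =>
    Pi.single (o.dart a).fst 1 + Pi.single (o.dart a).snd 1

theorem boundary_single (d : G.Dart) : o.boundary (Pi.single (o.arrow d) 1) =
    Pi.single d.fst 1 + Pi.single d.snd 1 := by
  rw [boundary, Fintype.linearCombination_apply_single, one_smul]
  rcases o.eq_or_eq_symm d with h | h
  · rw [← h]
  · conv_rhs => rw [h]
    exact add_comm _ _

omit [Fintype A] [DecidableEq V] in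
theorem chain_cons {u v w : V} (h : G.Adj u v) (p : G.Walk v w) :
    o.chain (.cons h p) = Pi.single (o.arrow ⟨(u, v), h⟩) 1 + o.chain p := by
  simp [chain]

theorem boundary_chain {u v : V} (p : G.Walk u v) :
    o.boundary (o.chain p) = Pi.single u 1 + Pi.single v 1 := by
  induction p with
  | nil => simp [chain, ZModModule.add_self]
  | cons h p ih =>
    rw [chain_cons, map_add, ih, boundary_single]
    dsimp only
    have cancel : ∀ a b : V → ZMod 2, a + (a + b) = b := fun a b => by
      rw [← add_assoc, ZModModule.add_self, zero_add]
    rw [add_assoc, cancel]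

omit [Fintype A] [DecidableEq V] in
theorem chain_reverse {u v : V} (p : G.Walk u v) : o.chain p.reverse = o.chain p := by
  rw [chain, SimpleGraph.Walk.darts_reverse, List.map_reverse, List.sum_reverse, List.map_map]
  simp [Function.comp_def, o.arrow_symm, chain]

omit [Fintype A] [DecidableEq V] in
theorem chain_append {u v w : V} (p : G.Walk u v) (q : G.Walk v w) :
    o.chain (p.append q) = o.chain p + o.chain q := by
  simp [chain]

variable [Fintype V]

/-- Paths from a root give a section of the boundary map, up to a correction at the root that
vanishes when `y` has even weight. -/
theorem boundary_sum_chain {r : V} (p : ∀ v, G.Walk r v) (y : V → ZMod 2) :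
    o.boundary (Fintype.linearCombination (ZMod 2) (fun v => o.chain (p v)) y) =
      (∑ v, y v) • Pi.single r 1 + y := by
  rw [Fintype.linearCombination_apply, map_sum]
  simp only [map_smul, boundary_chain, smul_add, Finset.sum_add_distrib, Finset.sum_smul]
  congr 1
  funext v
  simp [Pi.single_apply]

/-- Closing every edge of `x` to a loop through the root changes `x` by root paths indexed by its
boundary; these cancel when the boundary is zero. -/
theorem ker_boundary (hG : G.Connected) : LinearMap.ker o.boundary = o.cycleSpace := by
  apply le_antisymm
  · obtain ⟨r⟩ := hG.nonempty
    choose p _ using fun v => (hG.preconnected r v).exists_isPath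
    let h := Fintype.linearCombination (ZMod 2) fun v => o.chain (p v)
    have key : ∀ x, x + h (o.boundary x) ∈ o.cycleSpace := by
      intro x
      have hx : x = ∑ a, x a • Pi.single a (1 : ZMod 2) := by
        funext b; simp [Pi.single_apply]
      have hsum : x + h (o.boundary x) = ∑ a, x a • (Pi.single a 1 +
          h (o.boundary (Pi.single a 1))) := by
        conv_lhs => rw [hx]
        simp only [map_sum, map_smul, smul_add, Finset.sum_add_distrib]
      rw [hsum]
      refine sum_mem fun a _ => Submodule.smul_mem _ _ (Submodule.subset_span ?_)
      refine ⟨r, ((p (o.dart a).fst).append (.cons (o.dart a).adj .nil)).append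
        (p (o.dart a).snd).reverse, ?_⟩
      conv_lhs => rw [← o.arrow_dart a]
      rw [boundary_single, map_add, chain_append, chain_append, chain_reverse, chain_cons,
        Fintype.linearCombination_apply_single, Fintype.linearCombination_apply_single,
        one_smul, one_smul]
      simp only [chain, SimpleGraph.Walk.darts_nil, List.map_nil, List.sum_nil, add_zero]
      abel
    intro x hx
    simpa [LinearMap.mem_ker.1 hx] using key x
  · rw [cycleSpace, Submodule.span_le]
    rintro _ ⟨v, p, rfl⟩
    rw [SetLike.mem_coe, LinearMap.mem_ker, boundary_chain, ZModModule.add_self]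

/-- Rank–nullity: by connectedness the image of the boundary is the hyperplane of vectors with
coordinate sum zero. -/
theorem finrank_cycleSpace (hG : G.Connected) :
    Module.finrank (ZMod 2) o.cycleSpace + Fintype.card V = Fintype.card A + 1 := by
  obtain ⟨r⟩ := hG.nonempty
  choose p _ using fun v => (hG.preconnected r v).exists_isPath
  let ε : (V → ZMod 2) →ₗ[ZMod 2] ZMod 2 := Fintype.linearCombination (ZMod 2) fun _ => 1
  have hε : ∀ y, ε y = ∑ v, y v := fun y => by simp [ε, Fintype.linearCombination_apply]
  have hrange : LinearMap.range o.boundary = LinearMap.ker ε := by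
    apply le_antisymm
    · rw [boundary, Fintype.range_linearCombination, Submodule.span_le]
      rintro _ ⟨a, rfl⟩
      rw [SetLike.mem_coe, LinearMap.mem_ker, map_add, hε, hε]
      simp only [Finset.sum_pi_single', Finset.mem_univ, if_true]
      exact CharTwo.add_self_eq_zero _
    · intro y hy
      rw [LinearMap.mem_ker, hε] at hy
      exact ⟨_, by rw [boundary_sum_chain o p, hy, zero_smul, zero_add]⟩
  have hsurj : LinearMap.range ε = ⊤ := by
    rw [LinearMap.range_eq_top]
    intro c
    exact ⟨Pi.single r c, by rw [hε]; simp⟩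
  have h1 := LinearMap.finrank_range_add_finrank_ker o.boundary
  have h2 := LinearMap.finrank_range_add_finrank_ker ε
  rw [hsurj, finrank_top, Module.finrank_self, Module.finrank_fintype_fun_eq_card] at h2
  rw [hrange, ker_boundary o hG, Module.finrank_fintype_fun_eq_card] at h1
  omega

end Orientation
end FermionEncoding

namespace FermionEncoding

/-! ### Geometry of the tiling -/

theorem dir_add_three (j : ZMod 6) : dir (j + 3) = -dir j := by revert j; decide

theorem dir_ne_zero (j : ZMod 6) : dir j ≠ 0 := by revert j; decide

theorem dir_add_five (j : ZMod 6) : dir (j + 1) + dir (j + 5) = dir j := by revert j; decide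

/-- The other vertex with two outgoing arrows in the square that contains the outgoing arrows
of `u`. -/
def partner (u : Vertex) : Vertex := (u.1 + dir (u.2 + 1), u.2 + 3)

/-- The square that contains the outgoing arrows of `u`. -/
def squareOf (u : Vertex) : Finset Vertex := square u.1 (u.2 + 1)

/-- The triangle that contains `u`. -/
def triangleOf (u : Vertex) : Finset Vertex := triangle u.1 u.2

theorem partner_partner (u : Vertex) : partner (partner u) = u := by
  refine Prod.ext ?_ ?_
  · change u.1 + dir (u.2 + 1) + dir (u.2 + 3 + 1) = u.1
    rw [add_right_comm u.2 3 1, dir_add_three, add_neg_cancel_right]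
  · change u.2 + 3 + 3 = u.2
    rw [add_assoc]
    exact add_zero _

/-- The sides of a square alternate between the two types, and its corners between sources and
sinks: `u` and `partner u` are the sources, and each sink receives one arrow from each of them. -/
theorem hexNext_partner (u : Vertex) : hexNext (partner u) = triNext u :=
  Prod.ext rfl (add_assoc _ _ _)

theorem triNext_partner (u : Vertex) : triNext (partner u) = hexNext u := by
  rw [← hexNext_partner, partner_partner]

theorem triNext_triNext (u : Vertex) : triNext (triNext u) = (u.1 + dir u.2, u.2 + 2) := by
  refine Prod.ext ?_ ?_
  · change u.1 + dir (u.2 + 1) + dir (u.2 + 4 + 1) = u.1 + dir u.2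
    rw [add_assoc, add_assoc u.2]
    exact congrArg _ (dir_add_five u.2)
  · exact add_assoc _ _ _

theorem triNext_triNext_triNext (u : Vertex) : triNext (triNext (triNext u)) = u := by
  rw [triNext_triNext]
  refine Prod.ext ?_ ?_
  · change u.1 + dir (u.2 + 1) + dir (u.2 + 4) = u.1
    rw [show u.2 + 4 = u.2 + 1 + 3 by rw [add_assoc]; rfl, dir_add_three, add_neg_cancel_right]
  · change u.2 + 4 + 2 = u.2
    rw [add_assoc]
    exact add_zero _

theorem hexNext_injective : Function.Injective hexNext := fun _ _ h =>
  Prod.ext (congrArg Prod.fst h :) (add_right_cancel (congrArg Prod.snd h :))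

theorem triNext_injective : Function.Injective triNext := fun u w h => by
  rw [← triNext_triNext_triNext u, h, triNext_triNext_triNext]

theorem triNext_fst_ne (u : Vertex) : (triNext u).1 ≠ u.1 := fun h =>
  dir_ne_zero _ (add_eq_left.1 h)

theorem partner_fst_ne (u : Vertex) : (partner u).1 ≠ u.1 := fun h =>
  dir_ne_zero _ (add_eq_left.1 h)

theorem partner_ne (u : Vertex) : partner u ≠ u := fun h => partner_fst_ne u (by rw [h])

theorem triNext_ne (u : Vertex) : triNext u ≠ u := fun h => triNext_fst_ne u (by rw [h])

theorem hexNext_ne (u : Vertex) : hexNext u ≠ u := fun h =>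
  absurd (add_eq_left.1 (congrArg Prod.snd h :)) (by decide)

theorem hexNext_ne_triNext (u : Vertex) : hexNext u ≠ triNext u := fun h =>
  triNext_fst_ne u (congrArg Prod.fst h).symm

theorem hexNext_hexNext_ne (u : Vertex) : hexNext (hexNext u) ≠ u := fun h =>
  absurd (add_eq_left.1 ((add_assoc _ _ _).symm.trans (congrArg Prod.snd h :))) (by decide)

theorem triNext_triNext_ne (u : Vertex) : triNext (triNext u) ≠ u := fun h =>
  absurd (add_eq_left.1 ((add_assoc _ _ _).symm.trans (congrArg Prod.snd h :))) (by decide)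

theorem squareOf_eq (u : Vertex) : squareOf u = {u, hexNext u, partner u, triNext u} := by
  have h3 : u.2 + 1 + 2 = u.2 + 3 := add_assoc _ _ _
  have h4 : u.2 + 1 + 3 = u.2 + 4 := add_assoc _ _ _
  rw [squareOf, square, add_sub_cancel_right, h3, h4]
  rfl

theorem triangleOf_eq (u : Vertex) :
    triangleOf u = {u, triNext u, triNext (triNext u)} := by
  rw [triNext_triNext, triangleOf, triangle, Finset.pair_comm]
  rfl

theorem mem_squareOf {u v : Vertex} :
    v ∈ squareOf u ↔ v = u ∨ v = hexNext u ∨ v = partner u ∨ v = triNext u := by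
  simp [squareOf_eq]

theorem mem_triangleOf {u v : Vertex} :
    v ∈ triangleOf u ↔ v = u ∨ v = triNext u ∨ v = triNext (triNext u) := by
  simp [triangleOf_eq]

theorem mem_hexagon {x : ℤ × ℤ} {v : Vertex} : v ∈ hexagon x ↔ v.1 = x := by
  rw [hexagon, Finset.mem_image]
  exact ⟨by rintro ⟨k, -, rfl⟩; rfl, fun h => ⟨v.2, Finset.mem_univ _, Prod.ext h.symm rfl⟩⟩

theorem squareOf_partner (u : Vertex) : squareOf (partner u) = squareOf u := by
  ext v
  rw [mem_squareOf, mem_squareOf, partner_partner, hexNext_partner, triNext_partner]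
  tauto

theorem triangleOf_triNext (u : Vertex) : triangleOf (triNext u) = triangleOf u := by
  ext v
  rw [mem_triangleOf, mem_triangleOf, triNext_triNext_triNext]
  tauto

theorem triangleOf_eq_of_mem {u v : Vertex} (h : v ∈ triangleOf u) :
    triangleOf v = triangleOf u := by
  rcases mem_triangleOf.1 h with rfl | rfl | rfl
  · rfl
  · exact triangleOf_triNext u
  · rw [triangleOf_triNext, triangleOf_triNext]

/-- Only the two sources can start a hexagon arrow inside the square. The sinks are excluded, one
directly and the other by the symmetry `w ↔ partner w`. -/
theorem eq_of_hexNext_mem_squareOf {u w : Vertex} (h : u ∈ squareOf w)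
    (h' : hexNext u ∈ squareOf w) : u = w ∨ u = partner w := by
  have key : ∀ w, u = hexNext w → hexNext u ∈ squareOf w → False := by
    rintro w rfl h
    rcases mem_squareOf.1 h with h | h | h | h
    · exact hexNext_hexNext_ne _ h
    · exact hexNext_ne _ h
    · exact partner_fst_ne w (congrArg Prod.fst h).symm
    · exact triNext_fst_ne w (congrArg Prod.fst h).symm
  rcases mem_squareOf.1 h with h | h | h | h
  · exact .inl h
  · exact (key w h h').elim
  · exact .inr h
  · rw [← hexNext_partner] at h
    rw [← squareOf_partner] at h'
    exact (key _ h h').elim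

theorem squareOf_eq_iff {u w : Vertex} : squareOf u = squareOf w ↔ u = w ∨ u = partner w := by
  constructor
  · intro h
    apply eq_of_hexNext_mem_squareOf <;> rw [← h, mem_squareOf] <;> simp
  · rintro (rfl | rfl)
    · rfl
    · exact squareOf_partner w

theorem isSquare_squareOf (u : Vertex) : IsSquare (squareOf u) := ⟨_, _, rfl⟩

theorem exists_squareOf {f : Finset Vertex} (h : IsSquare f) : ∃ u, f = squareOf u := by
  obtain ⟨x, j, rfl⟩ := h
  exact ⟨(x, j - 1), by rw [squareOf, sub_add_cancel]⟩

theorem exists_triangleOf {f : Finset Vertex} (h : IsTriangle f) : ∃ u, f = triangleOf u := by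
  obtain ⟨x, k, rfl⟩ := h
  exact ⟨(x, k), rfl⟩

theorem isFace_squareOf (u : Vertex) : IsFace (squareOf u) := .inr (.inl (isSquare_squareOf u))

theorem isFace_triangleOf (u : Vertex) : IsFace (triangleOf u) := .inr (.inr ⟨_, _, rfl⟩)

theorem tiling_adj_hexNext (u : Vertex) : tiling.Adj u (hexNext u) :=
  (SimpleGraph.fromRel_adj _ _ _).2 ⟨(hexNext_ne u).symm, .inl (.inl rfl)⟩

theorem tiling_adj_triNext (u : Vertex) : tiling.Adj u (triNext u) :=
  (SimpleGraph.fromRel_adj _ _ _).2 ⟨(triNext_ne u).symm, .inl (.inr rfl)⟩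

/-! ### The faces, vertices and edges of a lattice -/

/-- The hypotheses on a lattice that determine its faces from its hexagons. -/
structure IsLattice (F : Finset (Finset Vertex)) : Prop where
  isFace : ∀ f ∈ F, IsFace f
  surrounded : HexagonsSurrounded F
  made : MadeOfHexagons F

namespace IsLattice

variable {F : Finset (Finset Vertex)} (hF : IsLattice F)
include hF

/-- The hexagons determine the lattice, since `hexagon v.1` is the unique hexagon through `v`. -/
theorem mem_iff {f : Finset Vertex} (hf : IsFace f) : f ∈ F ↔ ∃ v ∈ f, hexagon v.1 ∈ F := by
  constructor
  · intro h
    obtain ⟨g, hg, ⟨x, rfl⟩, v, hv⟩ := hF.made f h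
    rw [Finset.mem_inter, mem_hexagon] at hv
    exact ⟨v, hv.1, hv.2 ▸ hg⟩
  · rintro ⟨v, hv, h⟩
    exact hF.surrounded _ h ⟨_, rfl⟩ f hf ⟨v, Finset.mem_inter.2 ⟨hv, mem_hexagon.2 rfl⟩⟩

theorem squareOf_mem_iff {u : Vertex} :
    squareOf u ∈ F ↔ hexagon u.1 ∈ F ∨ hexagon (partner u).1 ∈ F := by
  rw [hF.mem_iff (isFace_squareOf u)]
  constructor
  · rintro ⟨v, hv, h⟩
    rcases mem_squareOf.1 hv with rfl | rfl | rfl | rfl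
    exacts [.inl h, .inl h, .inr h, .inr h]
  · rintro (h | h)
    · exact ⟨u, mem_squareOf.2 (by simp), h⟩
    · exact ⟨partner u, mem_squareOf.2 (by simp), h⟩

/-- A square at `u` lies between two hexagons that both meet the triangle at `u`, so whichever of
them is present brings the triangle with it. Hence every lattice vertex has an outgoing triangle
arrow. -/
theorem mem_vertices_iff {u : Vertex} : u ∈ F.biUnion id ↔ triangleOf u ∈ F := by
  rw [Finset.mem_biUnion]
  constructor
  · rintro ⟨f, hf, hu⟩
    change u ∈ f at hu
    rcases hF.isFace f hf with ⟨x, rfl⟩ | h | h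
    · rw [hF.mem_iff (isFace_triangleOf u)]
      exact ⟨u, mem_triangleOf.2 (.inl rfl), (mem_hexagon.1 hu).symm ▸ hf⟩
    · obtain ⟨w, rfl⟩ := exists_squareOf h
      have key : ∀ w, hexagon w.1 ∈ F ∨ hexagon (partner w).1 ∈ F → u = w ∨ u = hexNext w →
          triangleOf u ∈ F := by
        intro w h hu
        rw [hF.mem_iff (isFace_triangleOf u)]
        rcases h with h | h
        · exact ⟨u, mem_triangleOf.2 (.inl rfl), by rcases hu with rfl | rfl <;> exact h⟩
        · rcases hu with rfl | rfl
          · exact ⟨triNext u, mem_triangleOf.2 (by simp), h⟩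
          · refine ⟨partner w, mem_triangleOf.2 (.inr (.inr ?_)), h⟩
            rw [← triNext_partner, triNext_triNext_triNext]
      have hw := hF.squareOf_mem_iff.1 hf
      rcases mem_squareOf.1 hu with h | h | h | h
      · exact key w hw (.inl h)
      · exact key w hw (.inr h)
      · exact key (partner w) (by rw [partner_partner]; exact hw.symm) (.inl h)
      · exact key (partner w) (by rw [partner_partner]; exact hw.symm)
          (.inr (by rw [hexNext_partner, h]))
    · obtain ⟨w, rfl⟩ := exists_triangleOf h
      rwa [triangleOf_eq_of_mem hu]
  · exact fun h => ⟨_, h, mem_triangleOf.2 (.inl rfl)⟩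

theorem triNext_mem {u : Vertex} (hu : u ∈ F.biUnion id) : triNext u ∈ F.biUnion id := by
  rw [hF.mem_vertices_iff] at hu ⊢
  rwa [triangleOf_triNext]

omit hF in
theorem mem_vertices_of_mem {f : Finset Vertex} (hf : f ∈ F) {u : Vertex} (hu : u ∈ f) :
    u ∈ F.biUnion id := Finset.mem_biUnion.2 ⟨f, hf, hu⟩

/-- A side of a hexagon borders only that hexagon, which brings the square, and the square itself.
So only triangle arrows can lack their square qubit. -/
theorem squareOf_mem_of_hexNext {f : Finset Vertex} (hf : f ∈ F) {u : Vertex} (hu : u ∈ f)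
    (hu' : hexNext u ∈ f) : squareOf u ∈ F := by
  rcases hF.isFace f hf with ⟨x, rfl⟩ | h | h
  · rw [hF.squareOf_mem_iff]
    exact .inl ((mem_hexagon.1 hu).symm ▸ hf)
  · obtain ⟨w, rfl⟩ := exists_squareOf h
    rwa [squareOf_eq_iff.2 (eq_of_hexNext_mem_squareOf hu hu')]
  · obtain ⟨w, rfl⟩ := exists_triangleOf h
    rw [← triangleOf_eq_of_mem hu] at hu'
    rcases mem_triangleOf.1 hu' with h | h | h
    · exact (hexNext_ne u h).elim
    · exact (hexNext_ne_triNext u h).elim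
    · rw [triNext_triNext] at h
      exact (dir_ne_zero _ (add_eq_left.1 (congrArg Prod.fst h).symm)).elim

end IsLattice

/-- The sources of the arrows along hexagons. -/
abbrev HexSource (F : Finset (Finset Vertex)) : Type := {u : LatticeVertex F // squareOf u.1 ∈ F}

/-- The arrows of the lattice, labelled by their sources: those along triangles and those along
hexagons. -/
abbrev Arrow (F : Finset (Finset Vertex)) : Type := LatticeVertex F ⊕ HexSource F

namespace Arrow

variable {F : Finset (Finset Vertex)}

/-- The source of an arrow. -/
def src : Arrow F → LatticeVertex F
  | .inl u => u
  | .inr u => u.1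

/-- The Pauli operator that an arrow applies to the qubit of its square. -/
def pauli : Arrow F → Pauli
  | .inl _ => .Y
  | .inr _ => .X

/-- The target of an arrow. -/
def tgt (hF : IsLattice F) : Arrow F → LatticeVertex F
  | .inl u => ⟨triNext u.1, hF.triNext_mem u.2⟩
  | .inr u => ⟨hexNext u.1.1, IsLattice.mem_vertices_of_mem u.2 (mem_squareOf.2 (.inr (.inl rfl)))⟩

variable (hF : IsLattice F)

theorem adj (a : Arrow F) : (latticeGraph F).Adj a.src (a.tgt hF) := by
  rcases a with u | u
  · exact ⟨tiling_adj_triNext _, _, hF.mem_vertices_iff.1 u.2, mem_triangleOf.2 (.inl rfl),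
      mem_triangleOf.2 (.inr (.inl rfl))⟩
  · exact ⟨tiling_adj_hexNext _, _, u.2, mem_squareOf.2 (.inl rfl),
      mem_squareOf.2 (.inr (.inl rfl))⟩

/-- An arrow as a directed edge of the lattice. -/
def dart (a : Arrow F) : (latticeGraph F).Dart := ⟨(a.src, a.tgt hF), a.adj hF⟩

theorem exists_dart (d : (latticeGraph F).Dart) :
    ∃ a : Arrow F, d = a.dart hF ∨ d = (a.dart hF).symm := by
  have key : ∀ d : (latticeGraph F).Dart,
      d.snd.1 = hexNext d.fst.1 ∨ d.snd.1 = triNext d.fst.1 → ∃ a : Arrow F, d = a.dart hF := by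
    rintro d (h | h)
    · obtain ⟨-, f, hf, hu, hw⟩ := d.adj
      refine ⟨.inr ⟨d.fst, hF.squareOf_mem_of_hexNext hf hu (h ▸ hw)⟩, ?_⟩
      exact SimpleGraph.Dart.ext _ _ (Prod.ext rfl (Subtype.ext h))
    · exact ⟨.inl d.fst, SimpleGraph.Dart.ext _ _ (Prod.ext rfl (Subtype.ext h))⟩
  rcases ((SimpleGraph.fromRel_adj _ _ _).1 d.adj.1).2 with h | h
  · obtain ⟨a, ha⟩ := key d h
    exact ⟨a, .inl ha⟩
  · obtain ⟨a, ha⟩ := key d.symm h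
    exact ⟨a, .inr (by rw [← ha, SimpleGraph.Dart.symm_symm])⟩

theorem eq_of_src_tgt {a b : Arrow F} (h : a.src = b.src) (h' : a.tgt hF = b.tgt hF) : a = b := by
  rcases a with u | u <;> rcases b with w | w
  · exact congrArg _ h
  · obtain rfl : u = w.1 := h
    exact (hexNext_ne_triNext _ (congrArg Subtype.val h').symm).elim
  · obtain rfl : u.1 = w := h
    exact (hexNext_ne_triNext _ (congrArg Subtype.val h')).elim
  · exact congrArg _ (Subtype.ext h)

/-- No two arrows are opposite; with `eq_of_src_tgt` this makes the label of an undirected edge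
unique. -/
theorem src_ne_tgt {a b : Arrow F} (h : a.src = b.tgt hF) : a.tgt hF ≠ b.src := by
  intro h'
  have h1 := congrArg Subtype.val h
  have h2 := congrArg Subtype.val h'
  rcases a with u | u <;> rcases b with w | w <;> simp only [src, tgt] at h1 h2
  · rw [h1] at h2
    exact triNext_triNext_ne _ h2
  · rw [h1] at h2
    exact triNext_fst_ne (hexNext w.1.1) (congrArg Prod.fst h2 :)
  · rw [← h2] at h1
    exact triNext_fst_ne (hexNext u.1.1) (congrArg Prod.fst h1 :).symm
  · rw [h1] at h2
    exact hexNext_hexNext_ne _ h2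

/-- The orientation of the edges of the lattice by the arrows. -/
noncomputable def orientation : Orientation (latticeGraph F) (Arrow F) where
  dart := dart hF
  arrow d := (exists_dart hF d).choose
  arrow_dart a := by
    rcases (exists_dart hF (a.dart hF)).choose_spec with h | h
    · exact (eq_of_src_tgt hF (congrArg (·.fst) h) (congrArg (·.snd) h)).symm
    · exact (src_ne_tgt hF (congrArg (·.fst) h) (congrArg (·.snd) h)).elim
  arrow_symm d := by
    have key : ∀ a b : Arrow F, d = a.dart hF ∨ d = (a.dart hF).symm →
        d.symm = b.dart hF ∨ d.symm = (b.dart hF).symm → b = a := by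
      rintro a b (rfl | rfl) (h | h)
      · exact (src_ne_tgt hF (congrArg (·.snd) h) (congrArg (·.fst) h)).elim
      · exact (eq_of_src_tgt hF (congrArg (·.snd) h) (congrArg (·.fst) h)).symm
      · exact (eq_of_src_tgt hF (congrArg (·.fst) h) (congrArg (·.snd) h)).symm
      · exact (src_ne_tgt hF (congrArg (·.fst) h) (congrArg (·.snd) h)).elim
    exact key _ _ (exists_dart hF d).choose_spec (exists_dart hF d.symm).choose_spec
  eq_or_eq_symm d := (exists_dart hF d).choose_spec

end Arrow

end FermionEncoding

/-! ### The string map, its kernel and the rank of the stabilizer group -/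

namespace FermionEncoding

open PauliGroup

variable {F : Finset (Finset Vertex)}

/-- With `X` at the tail and `Y` at the head, the `X`-bit sees both ends and the `Z`-bit only the
head, so incoming and outgoing arrows can be separated. -/
theorem bitsFun_edgeString_inl {u w : LatticeVertex F} (h : u ≠ w) (P : Pauli)
    (v : LatticeVertex F) : bitsFun (edgeString F u w P) (.inl v) =
      ((if v = u then 1 else 0) + if v = w then 1 else 0, if v = w then 1 else 0) := by
  by_cases hu : v = u
  · subst hu
    simp [bitsFun, edgeString, h, Pauli.xBit, Pauli.zBit]
  · by_cases hw : v = w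
    · subst hw
      simp [bitsFun, edgeString, hu, Pauli.xBit, Pauli.zBit]
    · simp [bitsFun, edgeString, hu, hw, Pauli.xBit, Pauli.zBit]

theorem edgeString_inr (u w : LatticeVertex F) (P : Pauli) (f : {f : F // IsSquare f.1}) :
    edgeString F u w P (.inr f) = if f.1.1 = squareOf u.1 then P else .I := by
  unfold edgeString squareOf
  congr

/-- The square that contains an arrow along a hexagon. -/
def HexSource.square (u : HexSource F) : {f : F // IsSquare f.1} :=
  ⟨⟨squareOf u.1.1, u.2⟩, isSquare_squareOf _⟩

/-- The source of the other arrow along a hexagon in the same square. -/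
def HexSource.partner (u : HexSource F) : HexSource F :=
  ⟨⟨FermionEncoding.partner u.1.1, IsLattice.mem_vertices_of_mem u.2 (mem_squareOf.2 (by simp))⟩,
    by rw [squareOf_partner]; exact u.2⟩

namespace HexSource

theorem square_eq_iff {u w : HexSource F} : u.square = w.square ↔ u = w ∨ u = w.partner := by
  have h : u.square = w.square ↔ squareOf u.1.1 = squareOf w.1.1 :=
    ⟨fun h => congrArg (fun f => f.1.1) h, fun h => Subtype.ext (Subtype.ext h)⟩
  rw [h, squareOf_eq_iff]
  exact or_congr ⟨fun h => Subtype.ext (Subtype.ext h), fun h => by rw [h]⟩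
    ⟨fun h => Subtype.ext (Subtype.ext h), fun h => by rw [h]; rfl⟩

theorem square_partner (u : HexSource F) : u.partner.square = u.square :=
  square_eq_iff.2 (.inr rfl)

theorem partner_partner (u : HexSource F) : u.partner.partner = u :=
  Subtype.ext (Subtype.ext (FermionEncoding.partner_partner _))

theorem partner_ne (u : HexSource F) : u.partner ≠ u := fun h =>
  FermionEncoding.partner_ne u.1.1 (congrArg (fun w : HexSource F => w.1.1) h)

theorem square_surjective : Function.Surjective (square (F := F)) := by
  rintro ⟨⟨f, hf⟩, h⟩
  obtain ⟨u, rfl⟩ := exists_squareOf h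
  exact ⟨⟨⟨u, IsLattice.mem_vertices_of_mem hf (mem_squareOf.2 (.inl rfl))⟩, hf⟩, rfl⟩

/-- The fibres of `square` are the pairs of partners; a chosen section and a Boolean enumerate them.
-/
theorem card_eq : Fintype.card (HexSource F) = Fintype.card {f : F // IsSquare f.1} * 2 := by
  have hr := Function.rightInverse_surjInv (square_surjective (F := F))
  set r := Function.surjInv (square_surjective (F := F))
  have hbij : Function.Bijective fun p : {f : F // IsSquare f.1} × Bool =>
      if p.2 then r p.1 else (r p.1).partner := by
    constructor
    · rintro ⟨f, b⟩ ⟨g, c⟩ h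
      have hfg : f = g := by
        have h' := congrArg square h
        cases b <;> cases c <;> simpa [square_partner, hr _] using h'
      subst hfg
      cases b <;> cases c
      · rfl
      · exact (partner_ne _ h).elim
      · exact (partner_ne _ h.symm).elim
      · rfl
    · intro u
      rcases square_eq_iff.1 (hr u.square).symm with h | h
      · exact ⟨(u.square, true), h.symm⟩
      · exact ⟨(u.square, false), h.symm⟩
  rw [← Fintype.card_of_bijective hbij, Fintype.card_prod, Fintype.card_bool]

end HexSource

namespace Arrow

variable (hF : IsLattice F)

theorem tgt_inl_partner (u : HexSource F) : tgt hF (.inl u.partner.1) = tgt hF (.inr u) :=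
  Subtype.ext (triNext_partner u.1.1)

theorem tgt_inr_partner (u : HexSource F) : tgt hF (.inr u.partner) = tgt hF (.inl u.1) :=
  Subtype.ext (hexNext_partner u.1.1)

theorem tgt_inl_injective : Function.Injective fun u => tgt hF (.inl u) := fun _ _ h =>
  Subtype.ext (triNext_injective (congrArg Subtype.val h))

theorem tgt_inr_injective : Function.Injective fun u => tgt hF (.inr u) := fun _ _ h =>
  Subtype.ext (Subtype.ext (hexNext_injective (congrArg Subtype.val h)))

/-- The bits of the product of the edge operators of a chain. -/
noncomputable def stringMap : (Arrow F → ZMod 2) →ₗ[ZMod 2] (Qubit F → ZMod 2 × ZMod 2) :=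
  Fintype.linearCombination (ZMod 2) fun a => bitsFun (edgeString F a.src (a.tgt hF) a.pauli)

theorem stringMap_single (a : Arrow F) : stringMap hF (Pi.single a 1) =
    bitsFun (edgeString F a.src (a.tgt hF) a.pauli) := by
  rw [stringMap, Fintype.linearCombination_apply_single, one_smul]

theorem stringMap_inl (x : Arrow F → ZMod 2) (v : LatticeVertex F) :
    stringMap hF x (.inl v) = ((∑ a, if v = a.src then x a else 0) +
      ∑ a, if v = a.tgt hF then x a else 0, ∑ a, if v = a.tgt hF then x a else 0) := by
  rw [stringMap, Fintype.linearCombination_apply, Finset.sum_apply]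
  simp only [Pi.smul_apply, bitsFun_edgeString_inl (adj hF _).ne, Prod.smul_mk,
    smul_eq_mul, mul_ite, mul_one, mul_zero]
  refine Prod.ext ?_ Prod.snd_sum
  rw [Prod.fst_sum, ← Finset.sum_add_distrib]
  simp only [mul_add, mul_ite, mul_one, mul_zero]

/-- The chain of the boundary of a square. -/
def squareCycle (u : HexSource F) : Arrow F → ZMod 2 :=
  Pi.single (.inr u) 1 + Pi.single (.inl u.1) 1 +
    (Pi.single (.inr u.partner) 1 + Pi.single (.inl u.partner.1) 1)

theorem stringMap_squareCycle (u : HexSource F) : stringMap hF (squareCycle u) = 0 := by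
  rw [squareCycle, map_add, map_add, map_add, stringMap_single, stringMap_single,
    stringMap_single, stringMap_single, tgt_inl_partner, tgt_inr_partner]
  -- Here `a`, `d` indicate the two sources of the square and `b`, `c` its two sinks; each occurs
  -- twice.
  have two : ∀ a b c d : ZMod 2, (a + b + (a + c) + (d + c + (d + b)) = 0) ∧
      (b + c + (c + b) = 0) := by decide
  funext q
  rcases q with v | f
  · have hn := fun a : Arrow F => (adj hF a).ne
    have h1 : src (.inr u.partner) ≠ tgt hF (.inl u.1) := tgt_inr_partner hF u ▸ hn _
    have h2 : src (.inl u.partner.1) ≠ tgt hF (.inr u) := tgt_inl_partner hF u ▸ hn _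
    simp only [Pi.add_apply, bitsFun_edgeString_inl (hn _), bitsFun_edgeString_inl h1,
      bitsFun_edgeString_inl h2, Prod.mk_add_mk]
    exact Prod.ext (two _ _ _ _).1 (two 0 _ _ 0).2
  · simp only [Pi.add_apply, bitsFun, edgeString_inr, src, pauli]
    have : squareOf u.partner.1.1 = squareOf u.1.1 := squareOf_partner _
    rw [this]
    have h : ∀ a b : ZMod 2 × ZMod 2, a + b + (a + b) = 0 := by decide
    exact h _ _

variable (F) in
/-- The chain of a set of squares. -/
def squareChain : ({f : F // IsSquare f.1} → ZMod 2) →ₗ[ZMod 2] (Arrow F → ZMod 2) where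
  toFun s
    | .inl u => if h : squareOf u.1 ∈ F then s (HexSource.square ⟨u, h⟩) else 0
    | .inr u => s u.square
  map_add' s t := by
    funext a
    rcases a with u | u
    · by_cases h : squareOf u.1 ∈ F <;> simp [h]
    · rfl
  map_smul' r s := by
    funext a
    rcases a with u | u
    · by_cases h : squareOf u.1 ∈ F <;> simp [h]
    · rfl

theorem squareChain_single (u : HexSource F) :
    squareChain F (Pi.single u.square 1) = squareCycle u := by
  have key : ∀ w : HexSource F, (Pi.single u.square 1 : {f : F // IsSquare f.1} → ZMod 2) w.square =
      (if w = u then 1 else 0) + if w = u.partner then 1 else 0 := by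
    intro w
    rw [Pi.single_apply]
    simp only [HexSource.square_eq_iff]
    by_cases h1 : w = u
    · simp [h1, u.partner_ne.symm]
    · by_cases h2 : w = u.partner <;> simp [h1, h2, u.partner_ne]
  funext a
  rcases a with w | w
  · change (if h : squareOf w.1 ∈ F then _ else 0) = _
    by_cases h : squareOf w.1 ∈ F
    · have h' : ∀ u' : HexSource F, (⟨w, h⟩ : HexSource F) = u' ↔ w = u'.1 := fun _ =>
        Subtype.ext_iff
      rw [dif_pos h, key]
      simp only [h']
      simp [squareCycle, Pi.single_apply]
    · have h1 : w ≠ u.1 := fun h' => h (h' ▸ u.2)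
      have h2 : w ≠ u.partner.1 := fun h' => h (h' ▸ u.partner.2)
      rw [dif_neg h]
      simp [squareCycle, h1, h2]
  · change (Pi.single u.square 1 : {f : F // IsSquare f.1} → ZMod 2) w.square = _
    rw [key]
    simp [squareCycle, Pi.single_apply]

theorem squareChain_injective : Function.Injective (squareChain F) := by
  intro s t h
  funext f
  obtain ⟨u, rfl⟩ := HexSource.square_surjective f
  exact congrFun h (.inr u)

/-- The bits on vertex qubits already force constancy around squares: a vertex has at most two
outgoing and two incoming arrows, each pair in one square. -/
theorem ker_stringMap : LinearMap.ker (stringMap hF) = LinearMap.range (squareChain F) := by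
  apply le_antisymm
  · intro x hx
    rw [LinearMap.mem_ker] at hx
    have hin : ∀ v, (∑ a, if v = a.tgt hF then x a else 0) = 0 := fun v => by
      have h := congrArg Prod.snd (congrFun hx (.inl v))
      rwa [stringMap_inl] at h
    have hout : ∀ v, (∑ a : Arrow F, if v = a.src then x a else 0) = 0 := fun v => by
      have h : _ = (0 : ZMod 2) := congrArg Prod.fst (congrFun hx (.inl v))
      rwa [stringMap_inl, hin, add_zero] at h
    simp only [Fintype.sum_sum_type] at hin
    have hout : ∀ v, x (.inl v) + (∑ w : HexSource F, if v = w.1 then x (.inr w) else 0) = 0 := by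
      intro v
      have h := hout v
      rw [Fintype.sum_sum_type] at h
      have h' : (∑ w : LatticeVertex F, if v = w then x (.inl w) else 0) = x (.inl v) := by simp
      rw [← h']
      exact h
    -- Cancellation at a source, then at a sink, equates adjacent sides of a square.
    have h1 : ∀ u : HexSource F, x (.inl u.1) = x (.inr u) := by
      intro u
      have h := hout u.1
      rw [Finset.sum_eq_single u (fun w _ hw => if_neg fun h' => hw (Subtype.ext h'.symm)) (by simp),
        if_pos rfl] at h
      exact CharTwo.add_eq_zero.1 h
    have h2 : ∀ u : HexSource F, x (.inl u.1) = x (.inr u.partner) := by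
      intro u
      have h := hin (tgt hF (.inl u.1))
      rw [Finset.sum_eq_single u.1
          (fun w _ hw => if_neg fun h' => hw (tgt_inl_injective hF h'.symm)) (by simp), if_pos rfl,
        ← tgt_inr_partner, Finset.sum_eq_single u.partner
          (fun w _ hw => if_neg fun h' => hw (tgt_inr_injective hF h'.symm)) (by simp),
        if_pos rfl] at h
      exact CharTwo.add_eq_zero.1 h
    -- A triangle arrow without its square is the only arrow out of its tail.
    have h3 : ∀ u : LatticeVertex F, squareOf u.1 ∉ F → x (.inl u) = 0 := by
      intro u hu
      have h := hout u
      rwa [Finset.sum_eq_zero fun w _ => if_neg fun h' : u = w.1 => hu (h' ▸ w.2), add_zero] at h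
    have hr := Function.rightInverse_surjInv (HexSource.square_surjective (F := F))
    -- Partners have equal coefficients, so the chosen source of each square does not matter.
    have h4 : ∀ u : HexSource F,
        x (.inr (Function.surjInv HexSource.square_surjective u.square)) = x (.inr u) := by
      intro u
      rcases HexSource.square_eq_iff.1 (hr u.square) with h | h
      · rw [h]
      · rw [h, ← h1, h2, HexSource.partner_partner]
    refine ⟨fun f => x (.inr (Function.surjInv HexSource.square_surjective f)), ?_⟩
    funext a
    rcases a with u | u
    · change (if h : squareOf u.1 ∈ F then _ else 0) = _
      split_ifs with h
      · rw [h4 ⟨u, h⟩, ← h1]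
      · exact (h3 u h).symm
    · exact h4 u
  · rintro _ ⟨s, rfl⟩
    have hs : s = ∑ f, s f • Pi.single f (1 : ZMod 2) := by
      funext g; simp [Pi.single_apply]
    rw [LinearMap.mem_ker, hs, map_sum, map_sum]
    refine Finset.sum_eq_zero fun f _ => ?_
    obtain ⟨u, rfl⟩ := HexSource.square_surjective f
    rw [map_smul, map_smul, squareChain_single, stringMap_squareCycle, smul_zero]

/-- The `X`-bits on the vertex qubits are exactly the mod 2 boundary. -/
theorem ker_stringMap_le : LinearMap.ker (stringMap hF) ≤ LinearMap.ker (orientation hF).boundary := by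
  have key : ∀ x v, (orientation hF).boundary x v = (stringMap hF x (.inl v)).1 := by
    intro x v
    rw [Orientation.boundary, Fintype.linearCombination_apply, stringMap_inl, Finset.sum_apply,
      ← Finset.sum_add_distrib]
    refine Finset.sum_congr rfl fun a _ => ?_
    change x a • ((Pi.single a.src 1 : LatticeVertex F → ZMod 2) v +
      (Pi.single (a.tgt hF) 1 : LatticeVertex F → ZMod 2) v) = _
    simp [Pi.single_apply, mul_add]
  intro x hx
  rw [LinearMap.mem_ker] at hx ⊢
  funext v
  rw [key, hx]
  rfl

/-- The whole kernel consists of cycles, so restricting to the cycle space still loses one dimension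
per square. -/
theorem finrank_map_cycleSpace (hG : (latticeGraph F).Connected) :
    Module.finrank (ZMod 2) ((orientation hF).cycleSpace.map (stringMap hF)) =
      Fintype.card {f : F // IsSquare f.1} + 1 := by
  have h1 := (orientation hF).finrank_cycleSpace hG
  have h2 := LinearMap.finrank_range_add_finrank_ker
    ((stringMap hF).domRestrict (orientation hF).cycleSpace)
  have hle : LinearMap.ker (stringMap hF) ≤ (orientation hF).cycleSpace := by
    rw [← Orientation.ker_boundary _ hG]
    exact ker_stringMap_le hF
  rw [LinearMap.range_domRestrict, LinearMap.ker_domRestrict,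
    (Submodule.comapSubtypeEquivOfLe hle).finrank_eq, ker_stringMap,
    LinearMap.finrank_range_of_inj squareChain_injective, Module.finrank_fintype_fun_eq_card] at h2
  rw [Fintype.card_sum, HexSource.card_eq] at h1
  omega

end Arrow

open Arrow

/-- Homomorphisms from `M_G` to the Pauli group that are given by the Pauli strings of the lattice
up to phases. -/
structure IsStringRepresentation (hF : IsLattice F)
    (σ : MG (latticeGraph F) →* PauliGroup (Qubit F)) : Prop where
  phase : ∀ a, σ (MG.gen _ (.phase a)) = scalar _ a
  edge : ∀ a : Arrow F, (σ (MG.gen _ (.edge (a.dart hF)))).op =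
    edgeString F a.src (a.tgt hF) a.pauli

theorem IsLatticeEncoding.isStringRepresentation (hF : IsLattice F)
    {σ : MG (latticeGraph F) →* PauliGroup (Qubit F)} (hσ : IsLatticeEncoding F σ) :
    IsStringRepresentation hF σ where
  phase := hσ.isEncoding.phase
  edge a := by
    rcases a with u | u
    · obtain ⟨s, -, h⟩ := hσ.triEdge (dart hF (.inl u)) rfl
      rw [h]; rfl
    · obtain ⟨s, -, h⟩ := hσ.hexEdge (dart hF (.inr u)) rfl
      rw [h]; rfl

namespace IsStringRepresentation

variable {hF : IsLattice F} {σ : MG (latticeGraph F) →* PauliGroup (Qubit F)}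
  (hσ : IsStringRepresentation hF σ)
include hσ

theorem bits_phase (a : ZMod 4) : bits (σ (MG.gen _ (.phase a))) = 1 := by
  rw [hσ.phase]; rfl

theorem bits_edge (d : (latticeGraph F).Dart) : (bits (σ (MG.gen _ (.edge d)))).toAdd =
    stringMap hF (Pi.single ((orientation hF).arrow d) 1) := by
  have key : ∀ a : Arrow F, (bits (σ (MG.gen _ (.edge (a.dart hF))))).toAdd =
      stringMap hF (Pi.single a 1) := by
    intro a
    rw [stringMap_single, ← hσ.edge]
    rfl
  rcases (orientation hF).eq_or_eq_symm d with h | h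
  · conv_lhs => rw [h]
    exact key _
  · conv_lhs => rw [h]
    rw [gen_edge_symm, SimpleGraph.Dart.symm_symm, map_mul, map_mul, hσ.bits_phase, one_mul]
    exact key _

theorem bits_cycleElement {v : LatticeVertex F} (p : (latticeGraph F).Walk v v) :
    (bits (σ (cycleElement _ p))).toAdd = stringMap hF ((orientation hF).chain p) := by
  rw [cycleElement, map_mul, map_mul, hσ.bits_phase, one_mul, Orientation.chain]
  induction p.darts with
  | nil => simp
  | cons d l ih =>
    simp only [List.map_cons, List.prod_cons, List.sum_cons, map_mul, map_add, toAdd_mul]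
    rw [ih, hσ.bits_edge]

theorem mem_map_cycleSpace_iff (m : Qubit F → ZMod 2 × ZMod 2) :
    m ∈ (orientation hF).cycleSpace.map (stringMap hF) ↔
      ∃ a ∈ stabilizerGroup σ, (bits a).toAdd = m := by
  constructor
  · rintro ⟨x, hx, rfl⟩
    rw [SetLike.mem_coe] at hx
    induction hx using Submodule.span_induction with
    | mem x hx =>
      obtain ⟨v, p, rfl⟩ := hx
      exact ⟨_, Subgroup.mem_map_of_mem _ (Subgroup.subset_closure ⟨v, p, rfl⟩),
        hσ.bits_cycleElement p⟩
    | zero => exact ⟨1, one_mem _, by simp⟩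
    | add x y _ _ hx hy =>
      obtain ⟨a, ha, hx⟩ := hx
      obtain ⟨b, hb, hy⟩ := hy
      exact ⟨a * b, mul_mem ha hb, by simp [hx, hy]⟩
    | smul r x _ hx =>
      obtain ⟨a, ha, hx⟩ := hx
      rcases (by decide : ∀ r : ZMod 2, r = 0 ∨ r = 1) r with rfl | rfl
      · exact ⟨1, one_mem _, by simp⟩
      · exact ⟨a, ha, by rw [one_smul, hx]⟩
  · rintro ⟨_, ⟨c, hc, rfl⟩, rfl⟩
    rw [SetLike.mem_coe] at hc
    induction hc using Subgroup.closure_induction with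
    | mem c hc =>
      obtain ⟨v, p, rfl⟩ := hc
      exact ⟨_, Submodule.subset_span ⟨v, p, rfl⟩, (hσ.bits_cycleElement p).symm⟩
    | one => simp
    | mul a b _ _ ha hb => simpa using add_mem ha hb
    | inv a _ ha => simpa using ha

end IsStringRepresentation

/-- The stabilizer group of an encoding meets the phases trivially. -/
theorem IsEncoding.eq_one_of_bits {V Q : Type} {G : SimpleGraph V} [Fintype Q]
    {σ : MG G →* PauliGroup Q} (hσ : IsEncoding σ) {a : PauliGroup Q}
    (ha : a ∈ stabilizerGroup σ) (h : bits a = 1) : a = 1 := by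
  have hsq : a * a = scalar Q (2 * a.phase) := mul_self_eq a
  have hneg := hσ.neg_one_notMem
  have heq := eq_scalar_of_bits h
  -- The last case is `±i`, whose square is `-1`.
  have hcases : ∀ c : ZMod 4, c = 0 ∨ c = 2 ∨ 2 * c = 2 := by decide
  rcases hcases a.phase with hc | hc | hc
  · rw [heq, hc]; rfl
  · rw [hc] at heq
    exact (hneg (heq ▸ ha)).elim
  · rw [hc] at hsq
    exact (hneg (hsq ▸ mul_mem ha ha)).elim

theorem IsLatticeEncoding.disparity_eq (hF : IsLattice F) (hG : (latticeGraph F).Connected)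
    {σ : MG (latticeGraph F) →* PauliGroup (Qubit F)} (hσ : IsLatticeEncoding F σ) :
    disparity σ = -1 := by
  rw [disparity, rank_eq_finrank (stabilizerGroup σ) bits
    (fun a ha h => hσ.isEncoding.eq_one_of_bits ha h) _
    (hσ.isStringRepresentation hF).mem_map_cycleSpace_iff, finrank_map_cycleSpace hF hG,
    Fintype.card_sum]
  push_cast
  ring

end FermionEncoding

/-! ### The Jordan–Wigner representation and the exclusion of `-1` -/

namespace FermionEncoding

open PauliGroup

section Fermionic

variable {V : Type} [Fintype V] {G : SimpleGraph V}

open Classical in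
/-- The Jordan–Wigner representation of the Majorana operators. -/
noncomputable def majorana (j : V) : PauliGroup V :=
  ⟨0, fun k => if k = j then .X else
    if Fintype.equivFin V k < Fintype.equivFin V j then .Z else .I⟩

open Classical in
/-- The Pauli operator `Z_j`. -/
noncomputable def parity (j : V) : PauliGroup V := ⟨0, fun k => if k = j then .Z else .I⟩

theorem majorana_sq (j : V) : majorana j * majorana j = 1 := by
  rw [mul_self_eq]; rfl

open Classical in
theorem form_majorana_parity (j k : V) :
    form (majorana j) (parity k) = if k = j then 1 else 0 := by
  rw [form, Finset.sum_eq_single k]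
  · by_cases h : k = j
    · simp [majorana, parity, h, Pauli.xBit, Pauli.zBit]
    · simp only [majorana, parity, h, if_true, if_false]
      split_ifs <;> rfl
  · intro l _ h
    simp [parity, h, Pauli.xBit, Pauli.zBit]
  · simp

-- For distinct indices the operator of the later vertex has a `Z` where the earlier one has its
-- `X`, and this is the only clash.
open Classical in
theorem form_majorana (i j : V) : form (majorana i) (majorana j) = if i = j then 0 else 1 := by
  have hx : ∀ i k : V, ((majorana i).op k).xBit = if k = i then 1 else 0 := by
    intro i k
    simp only [majorana]
    split_ifs <;> rfl
  have hz : ∀ i k : V, ((majorana i).op k).zBit =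
      if Fintype.equivFin V k < Fintype.equivFin V i then 1 else 0 := by
    intro i k
    simp only [majorana]
    split_ifs with h h'
    · rw [h] at h'
      exact (lt_irrefl _ h').elim
    all_goals rfl
  have hs : ∀ (i : V) (g : V → ZMod 2), ∑ k, (if k = i then 1 else 0) * g k = g i := by simp
  simp only [form, hx, hz, Finset.sum_add_distrib, hs]
  rw [Finset.sum_congr rfl fun k _ => mul_comm _ _, hs]
  rcases lt_trichotomy (Fintype.equivFin V i) (Fintype.equivFin V j) with h | h | h
  · have hne : i ≠ j := fun h' => h.ne (by rw [h'])
    simp [h, h.not_gt, hne]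
  · simp [(Fintype.equivFin V).injective h]
  · have hne : i ≠ j := fun h' => h.ne (by rw [h'])
    simp [h, h.not_gt, hne]

theorem majorana_comm {i j : V} (h : i ≠ j) :
    majorana i * majorana j = scalar V 2 * majorana j * majorana i :=
  mul_eq_of_form_one (by rw [form_majorana, if_neg h])

theorem majorana_mul_comm {i j : V} (h : i ≠ j) :
    majorana i * majorana j = scalar V 2 * (majorana j * majorana i) := by
  rw [majorana_comm h, mul_assoc]

theorem majorana_mul_sq {i j : V} (h : i ≠ j) :
    majorana i * majorana j * (majorana i * majorana j) = scalar V 2 := by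
  have h1 : majorana j * majorana i * (majorana i * majorana j) = 1 := by
    rw [mul_assoc, ← mul_assoc (majorana i), majorana_sq, one_mul, majorana_sq]
  nth_rewrite 1 [majorana_mul_comm h]
  rw [mul_assoc, h1, mul_one]

/-- The elements attached to closed walks are trivial in the fermionic representation. -/
theorem exists_fermionic_representation (G : SimpleGraph V) : ∃ τ : MG G →* PauliGroup V,
    (∀ a, τ (MG.gen G (.phase a)) = scalar V a) ∧
      ∀ (v : V) (p : G.Walk v v), τ (cycleElement G p) = 1 := by
  classical
  have hcomm := fun a (x : PauliGroup V) => scalar_comm a x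
  -- Edges go to `-i γ_j γ_k`, since `scalar 3` is `-i`; this makes them square to `1` and cancels
  -- the `i` per edge in a cycle element.
  obtain ⟨τ, hphase, -, hedge⟩ := exists_representation (G := G) parity
    (fun d => scalar V 3 * (majorana d.fst * majorana d.snd)) (fun i => by rw [mul_self_eq]; rfl)
    (fun d => by
      rw [mul_assoc, ← mul_assoc _ (scalar V 3), ← hcomm 3, mul_assoc (scalar V 3),
        majorana_mul_sq d.fst_ne_snd, scalar_mul_scalar, scalar_mul_scalar]
      rfl)
    (fun d => by
      rw [majorana_mul_comm d.fst_ne_snd, ← mul_assoc, ← mul_assoc (scalar V 2),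
        scalar_mul_scalar, scalar_mul_scalar]
      rfl)
    (fun i j => by
      rw [form]
      refine Finset.sum_eq_zero fun k _ => ?_
      simp only [parity]
      split_ifs <;> rfl)
    (fun d k => by
      rw [form_mul_left, form_mul_left, form_scalar_left, zero_add, form_majorana_parity,
        form_majorana_parity])
    (fun d d' h₁ h₂ h₃ h₄ => by
      rw [form_mul_left, form_mul_left, form_scalar_left, form_mul_right, form_mul_right,
        form_mul_right, form_mul_right, form_scalar_right, form_scalar_right, form_majorana,
        form_majorana, form_majorana, form_majorana, if_neg h₁, if_neg h₂, if_neg h₃, if_neg h₄]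
      decide)
    (fun d d' h₁ h₂ => by
      have h₃ : d.fst ≠ d'.fst := h₁ ▸ d.fst_ne_snd
      have h₄ : d.snd ≠ d'.snd := h₁ ▸ d'.fst_ne_snd
      rw [form_mul_left, form_mul_left, form_scalar_left, form_mul_right, form_mul_right,
        form_mul_right, form_mul_right, form_scalar_right, form_scalar_right, form_majorana,
        form_majorana, form_majorana, form_majorana, if_pos h₁, if_neg h₂, if_neg h₃, if_neg h₄]
      decide)
  refine ⟨τ, hphase, ?_⟩
  -- For an open walk the product telescopes to the Majorana operators of its two ends.
  have key : ∀ {u v : V} (p : G.Walk u v), τ (MG.gen G (.phase (p.length : ZMod 4)) *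
      (p.darts.map fun d => MG.gen G (.edge d)).prod) = majorana u * majorana v := by
    intro u v p
    induction p with
    | nil =>
      rw [majorana_sq, map_mul, hphase]
      simp only [SimpleGraph.Walk.length_nil, SimpleGraph.Walk.darts_nil, List.map_nil,
        List.prod_nil, map_one, mul_one, Nat.cast_zero]
      rfl
    | @cons u w v h p ih =>
      rw [map_mul, hphase] at ih
      simp only [SimpleGraph.Walk.length_cons, SimpleGraph.Walk.darts_cons, List.map_cons,
        List.prod_cons, map_mul, hphase, hedge]
      calc _ = scalar V (((p.length + 1 : ℕ) : ZMod 4) + 3) * (majorana u * majorana w) *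
            τ (p.darts.map fun d => MG.gen G (.edge d)).prod := by
              rw [← scalar_mul_scalar]; simp only [mul_assoc]
        _ = majorana u * majorana w * (scalar V (p.length : ZMod 4) *
            τ (p.darts.map fun d => MG.gen G (.edge d)).prod) := by
              have h4 : ((p.length + 1 : ℕ) : ZMod 4) + 3 = (p.length : ZMod 4) := by
                push_cast
                rw [add_assoc]
                exact add_zero _
              rw [h4, hcomm, mul_assoc]
        _ = _ := by
              rw [ih, mul_assoc, ← mul_assoc (majorana w), majorana_sq, one_mul]
  intro v p
  rw [cycleElement, key, majorana_sq]

/-- A representation has no `-1` among its stabilizers if its scalar stabilizers come from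
relations between trivially represented cycles. -/
theorem neg_one_notMem_stabilizerGroup {Q : Type} [Fintype Q] {σ : MG G →* PauliGroup Q}
    (h : ∀ c ∈ cycleGroup G, bits (σ c) = 1 → ∃ c' ∈ cycleGroup G, σ c' = 1 ∧
      (QuotientGroup.mk c' : MG G ⧸ signs G) = QuotientGroup.mk c) :
    scalar Q 2 ∉ stabilizerGroup σ := by
  rintro ⟨c, hc, hσc⟩
  obtain ⟨τ, hphase, hτ⟩ := exists_fermionic_representation G
  have hker : cycleGroup G ≤ τ.ker := by
    rw [cycleGroup, Subgroup.closure_le]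
    rintro _ ⟨v, p, rfl⟩
    exact hτ v p
  obtain ⟨c', hc', hσc', hmk⟩ := h c hc (by rw [hσc]; rfl)
  -- The quotient is `±1`, and `τ` detects the sign while killing the cycle group.
  have hmem : c'⁻¹ * c = 1 := by
    rcases mem_signs (QuotientGroup.eq.1 hmk) with h1 | h1
    · exact h1
    · have h2 : τ (c'⁻¹ * c) = 1 := hker (mul_mem (inv_mem hc') hc)
      rw [h1, hphase] at h2
      exact absurd (congrArg PauliGroup.phase h2) (by decide : (2 : ZMod 4) ≠ 0)
  rw [inv_mul_eq_one] at hmem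
  rw [← hmem, hσc'] at hσc
  exact absurd (congrArg PauliGroup.phase hσc) (by decide : (0 : ZMod 4) ≠ 2)

end Fermionic

/-! ### Classes modulo signs determined by mod 2 chains -/

namespace Orientation

variable {V A : Type} [DecidableEq A] [Fintype A] {G : SimpleGraph V} (o : Orientation G A)

/-- `(i e)² = -1`, so `i e` has trivial square modulo signs and exponents mod 2 make sense. -/
theorem mk_phase_mul_edge_sq (d : G.Dart) :
    (QuotientGroup.mk (MG.gen G (.phase 1) * MG.gen G (.edge d)) : MG G ⧸ signs G) *
      QuotientGroup.mk (MG.gen G (.phase 1) * MG.gen G (.edge d)) = 1 := by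
  rw [← QuotientGroup.mk_mul, mul_assoc, ← mul_assoc (MG.gen G (.edge d)), ← gen_phase_comm,
    mul_assoc, gen_edge_sq, mul_one, gen_phase_mul]
  exact mk_phase_two

/-- The class of the product of the edges of a chain. -/
noncomputable def chainClass (x : A → ZMod 2) : MG G ⧸ signs G :=
  ∏ a, (QuotientGroup.mk (MG.gen G (.phase 1) * MG.gen G (.edge (o.dart a))) :
    MG G ⧸ signs G) ^ (x a).val

omit [DecidableEq A] in
theorem chainClass_zero : o.chainClass 0 = 1 := by
  simp [chainClass]

omit [DecidableEq A] in
theorem chainClass_add (x y : A → ZMod 2) :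
    o.chainClass (x + y) = o.chainClass x * o.chainClass y := by
  rw [chainClass, chainClass, chainClass, ← Finset.prod_mul_distrib]
  refine Finset.prod_congr rfl fun a _ => ?_
  rw [← pow_add, Pi.add_apply, ZMod.val_add]
  exact (pow_eq_pow_mod _ (by rw [pow_two]; exact mk_phase_mul_edge_sq _)).symm

omit [DecidableEq A] in
theorem chainClass_inv (x : A → ZMod 2) : (o.chainClass x)⁻¹ = o.chainClass x := by
  rw [inv_eq_iff_mul_eq_one, ← chainClass_add, ZModModule.add_self, chainClass_zero]

theorem chainClass_single (d : G.Dart) : o.chainClass (Pi.single (o.arrow d) 1) =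
    QuotientGroup.mk (MG.gen G (.phase 1) * MG.gen G (.edge d)) := by
  rw [chainClass, Finset.prod_eq_single (o.arrow d)]
  · have h1 : (1 : ZMod 2).val = 1 := rfl
    rw [Pi.single_eq_same, h1, pow_one]
    rcases o.eq_or_eq_symm d with h | h
    · rw [← h]
    · conv_rhs => rw [h]
      rw [QuotientGroup.mk_mul, QuotientGroup.mk_mul, mk_edge_symm]
  · intro a _ h
    rw [Pi.single_eq_of_ne h, ZMod.val_zero, pow_zero]
  · simp

/-- The prefactor `i ^ n` distributes as one `i` per edge, which is why `chainClass` is built from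
`i e`. -/
theorem mk_cycleElement {v : V} (p : G.Walk v v) :
    (QuotientGroup.mk (cycleElement G p) : MG G ⧸ signs G) = o.chainClass (o.chain p) := by
  have key : ∀ {u v : V} (p : G.Walk u v), (QuotientGroup.mk (MG.gen G (.phase (p.length : ZMod 4)) *
      (p.darts.map fun d => MG.gen G (.edge d)).prod) : MG G ⧸ signs G) =
        o.chainClass (o.chain p) := by
    intro u v p
    induction p with
    | nil =>
      simp [chain, chainClass_zero, gen_phase_zero]
    | @cons u w v h p ih =>
      rw [chain_cons, chainClass_add, ← ih, chainClass_single]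
      simp only [SimpleGraph.Walk.length_cons, SimpleGraph.Walk.darts_cons, List.map_cons,
        List.prod_cons, Nat.cast_add, Nat.cast_one, ← gen_phase_mul, QuotientGroup.mk_mul]
      rw [mul_comm (QuotientGroup.mk (MG.gen G (.phase (p.length : ZMod 4))) : MG G ⧸ signs G)]
      exact mul_mul_mul_comm _ _ _ _
  exact key p

end Orientation

end FermionEncoding

/-! ### Signed edge operators and their commutation relations -/

namespace FermionEncoding

open PauliGroup

variable {F : Finset (Finset Vertex)} (hF : IsLattice F)

namespace Arrow

/-- The sign of an edge operator: one of the two arrows along hexagons in every square gets a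
minus sign. -/
def sign : Arrow F → ZMod 4
  | .inl _ => 0
  | .inr u => if u.1.1.2 = 5 ∨ u.1.1.2 = 0 ∨ u.1.1.2 = 1 then 2 else 0

theorem two_mul_sign (a : Arrow F) : 2 * a.sign = 0 := by
  rcases a with u | u
  · rfl
  · simp only [sign]
    split_ifs <;> rfl

/-- Passing to the partner adds `3` to the corner index and so exchanges `{5, 0, 1}` with its
complement. -/
theorem sign_partner (u : HexSource F) : sign (.inr u) + sign (.inr u.partner) = 2 := by
  have h : ∀ k : ZMod 6, (if k = 5 ∨ k = 0 ∨ k = 1 then (2 : ZMod 4) else 0) +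
      (if k + 3 = 5 ∨ k + 3 = 0 ∨ k + 3 = 1 then 2 else 0) = 2 := by decide
  exact h u.1.1.2

/-- The operator of an arrow. -/
noncomputable def operator (a : Arrow F) : PauliGroup (Qubit F) :=
  ⟨a.sign, edgeString F a.src (a.tgt hF) a.pauli⟩

theorem operator_sq (a : Arrow F) : a.operator hF * a.operator hF = 1 := by
  rw [mul_self_eq, operator, two_mul_sign]
  rfl

theorem form_operator_vertex (a : Arrow F) (k : LatticeVertex F) :
    form (a.operator hF) ⟨0, vertexString F k⟩ =
      (if k = a.src then 1 else 0) + if k = a.tgt hF then 1 else 0 := by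
  rw [form, Finset.sum_eq_single (.inl k)]
  · have h := congrArg Prod.fst (bitsFun_edgeString_inl (a.adj hF).ne a.pauli k)
    change (edgeString F a.src (a.tgt hF) a.pauli (.inl k)).xBit = _ at h
    have hk : vertexString F k (.inl k) = .Z := if_pos rfl
    simp only [operator, h, hk]
    exact (congrArg₂ _ (mul_one _) (mul_zero _)).trans (add_zero _)
  · rintro (v | f) _ h
    · have hv : v ≠ k := fun h' => h (by rw [h'])
      simp [vertexString, hv, Pauli.xBit, Pauli.zBit]
    · simp [vertexString, Pauli.xBit, Pauli.zBit]
  · simp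

/-- The left side says when the square qubit contributes to anticommutation. Types alternate around
a square, so it does for exactly the distinct arrows with a common tail or head. -/
theorem square_rel_iff {a b : Arrow F} :
    (a.pauli ≠ b.pauli ∧ squareOf a.src.1 = squareOf b.src.1) ↔
      (a ≠ b ∧ (a.src = b.src ∨ a.tgt hF = b.tgt hF)) := by
  have key : ∀ (u : LatticeVertex F) (w : HexSource F), squareOf u.1 = squareOf w.1.1 ↔
      (u = w.1 ∨ tgt hF (.inl u) = tgt hF (.inr w)) := by
    intro u w
    rw [squareOf_eq_iff, ← tgt_inl_partner, (tgt_inl_injective hF).eq_iff, Subtype.ext_iff,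
      Subtype.ext_iff]
    rfl
  rcases a with u | u <;> rcases b with w | w
  · simp only [pauli, ne_eq, not_true_eq_false, false_and, src, Sum.inl.injEq, false_iff, not_and,
      not_or]
    exact fun h => ⟨h, fun h' => h (tgt_inl_injective hF h')⟩
  · simpa [pauli, src] using key u w
  · have h := key w u
    simp only [eq_comm (a := squareOf w.1), eq_comm (a := w), eq_comm (a := tgt hF (.inl w))] at h
    simpa [pauli, src] using h
  · simp only [pauli, ne_eq, not_true_eq_false, false_and, src, Sum.inr.injEq, false_iff, not_and,
      not_or]
    exact fun h => ⟨fun h' => h (Subtype.ext h'), fun h' => h (tgt_inr_injective hF h')⟩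

open Classical in
theorem form_operator (a b : Arrow F) : form (a.operator hF) (b.operator hF) =
    (if a.src = b.tgt hF then 1 else 0) + (if a.tgt hF = b.src then 1 else 0) +
      if a ≠ b ∧ (a.src = b.src ∨ a.tgt hF = b.tgt hF) then 1 else 0 := by
  rw [if_congr (square_rel_iff hF).symm rfl rfl, form, Fintype.sum_sum_type]
  congr 1
  · have hx : ∀ (a : Arrow F) v, ((a.operator hF).op (.inl v)).xBit =
        (if v = a.src then 1 else 0) + if v = a.tgt hF then 1 else 0 := fun a v =>
      congrArg Prod.fst (bitsFun_edgeString_inl (a.adj hF).ne a.pauli v)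
    have hz : ∀ (a : Arrow F) v, ((a.operator hF).op (.inl v)).zBit =
        if v = a.tgt hF then 1 else 0 := fun a v =>
      congrArg Prod.snd (bitsFun_edgeString_inl (a.adj hF).ne a.pauli v)
    have hs : ∀ (u : LatticeVertex F) (g : LatticeVertex F → ZMod 2),
        ∑ v, (if v = u then 1 else 0) * g v = g u := by simp
    simp only [hx, hz, add_mul, mul_add, Finset.sum_add_distrib, hs]
    -- `q` is a common head, counted twice because `Y` commutes with `Y`; a head meeting a tail
    -- survives.
    have h2 : ∀ p q r : ZMod 2, p + q + (r + q) = p + r := by decide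
    rw [h2]
  · have hop : ∀ (a : Arrow F) (f : {f : F // IsSquare f.1}), (a.operator hF).op (.inr f) =
        if f.1.1 = squareOf a.src.1 then a.pauli else .I := fun a f =>
      edgeString_inr a.src (a.tgt hF) a.pauli f
    simp only [hop]
    by_cases h : squareOf a.src.1 = squareOf b.src.1
    · by_cases hp : a.pauli = b.pauli
      · rw [if_neg (fun h' => h'.1 hp)]
        refine Finset.sum_eq_zero fun f _ => ?_
        rw [h, hp, mul_comm, CharTwo.add_self_eq_zero]
      · rw [if_pos ⟨hp, h⟩]
        -- Different types mean that one arrow runs along a hexagon, so the square qubit exists.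
        have hmem : squareOf a.src.1 ∈ F := by
          rcases a with u | u
          · rcases b with w | w
            · exact (hp rfl).elim
            · rw [h]; exact w.2
          · exact u.2
        rw [Finset.sum_eq_single ⟨⟨_, hmem⟩, isSquare_squareOf _⟩]
        · simp only [← h, if_true]
          rcases a with u | u <;> rcases b with w | w
          · exact (hp rfl).elim
          · rfl
          · rfl
          · exact (hp rfl).elim
        · intro f _ hf
          have hf' : f.1.1 ≠ squareOf a.src.1 := fun h' => hf (Subtype.ext (Subtype.ext h'))
          rw [← h, if_neg hf', if_neg hf']
          rfl
        · simp
    · rw [if_neg (fun h' => h h'.2)]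
      refine Finset.sum_eq_zero fun f _ => ?_
      by_cases hf : f.1.1 = squareOf a.src.1
      · have hf' : f.1.1 ≠ squareOf b.src.1 := fun h' => h (hf.symm.trans h')
        rw [if_neg hf']
        simp [Pauli.xBit, Pauli.zBit]
      · rw [if_neg hf]
        simp [Pauli.xBit, Pauli.zBit]

open Classical in
/-- The operator of a directed edge. -/
noncomputable def dartOperator (d : (latticeGraph F).Dart) : PauliGroup (Qubit F) :=
  if d = dart hF ((orientation hF).arrow d) then ((orientation hF).arrow d).operator hF
  else scalar _ 2 * ((orientation hF).arrow d).operator hF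

theorem dart_ne_symm (a : Arrow F) : (a.dart hF).symm ≠ a.dart hF := fun h =>
  (a.adj hF).ne (congrArg (·.snd) h)

theorem dartOperator_dart (a : Arrow F) : dartOperator hF (a.dart hF) = a.operator hF := by
  have h : (orientation hF).arrow (a.dart hF) = a := (orientation hF).arrow_dart a
  rw [dartOperator, h, if_pos rfl]

theorem dartOperator_dart_symm (a : Arrow F) :
    dartOperator hF (a.dart hF).symm = scalar _ 2 * a.operator hF := by
  have h : (orientation hF).arrow (a.dart hF).symm = a :=
    ((orientation hF).arrow_symm _).trans ((orientation hF).arrow_dart a)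
  rw [dartOperator, h, if_neg (dart_ne_symm hF a)]

open Classical in
theorem exists_string_representation : ∃ σ : MG (latticeGraph F) →* PauliGroup (Qubit F),
    (∀ a, σ (MG.gen _ (.phase a)) = scalar _ a) ∧
      (∀ v, σ (MG.gen _ (.vertex v)) = ⟨0, vertexString F v⟩) ∧
      ∀ d, σ (MG.gen _ (.edge d)) = dartOperator hF d := by
  apply exists_representation
  · intro v
    rw [mul_self_eq]; rfl
  · intro d
    obtain ⟨a, rfl | rfl⟩ := exists_dart hF d
    · rw [dartOperator_dart, operator_sq]
    · rw [dartOperator_dart_symm, mul_assoc, ← mul_assoc (a.operator hF), ← scalar_comm, mul_assoc,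
        operator_sq, mul_one, scalar_mul_scalar]
      rfl
  · intro d
    obtain ⟨a, rfl | rfl⟩ := exists_dart hF d
    · rw [dartOperator_dart_symm, dartOperator_dart, ← mul_assoc, scalar_mul_scalar]
      exact (one_mul _).symm
    · rw [SimpleGraph.Dart.symm_symm, dartOperator_dart_symm, dartOperator_dart]
  · intro i j
    refine Finset.sum_eq_zero fun q _ => ?_
    rcases q with v | f
    · simp only [vertexString]
      split_ifs <;> rfl
    · rfl
  · intro d k
    obtain ⟨a, rfl | rfl⟩ := exists_dart hF d
    · rw [dartOperator_dart, form_operator_vertex]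
      congr
    · rw [dartOperator_dart_symm, form_mul_left, form_scalar_left, zero_add, form_operator_vertex,
        add_comm]
      congr
  · intro d d' h₁ h₂ h₃ h₄
    have key : ∀ a b : Arrow F, a.src ≠ b.src → a.src ≠ b.tgt hF → a.tgt hF ≠ b.src →
        a.tgt hF ≠ b.tgt hF → form (a.operator hF) (b.operator hF) = 0 := by
      intro a b h₁ h₂ h₃ h₄
      rw [form_operator]
      simp [h₁, h₂, h₃, h₄]
    obtain ⟨a, rfl | rfl⟩ := exists_dart hF d <;> obtain ⟨b, rfl | rfl⟩ := exists_dart hF d' <;>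
      simp only [dartOperator_dart, dartOperator_dart_symm, form_mul_left, form_mul_right,
        form_scalar_left, form_scalar_right, zero_add]
    · exact key a b h₁ h₂ h₃ h₄
    · exact key a b h₂ h₁ h₄ h₃
    · exact key a b h₃ h₄ h₁ h₂
    · exact key a b h₄ h₃ h₂ h₁
  · intro d d' h₁ h₂
    have hn := fun a : Arrow F => (a.adj hF).ne
    have key : ∀ a b : Arrow F, a.tgt hF = b.src → a.src ≠ b.tgt hF →
        form (a.operator hF) (b.operator hF) = 1 := by
      intro a b h₁ h₂
      have h₃ : a.src ≠ b.src := h₁ ▸ hn a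
      have h₄ : a.tgt hF ≠ b.tgt hF := h₁ ▸ hn b
      rw [form_operator, if_neg h₂, if_pos h₁, if_neg (by tauto)]
      rfl
    -- If exactly one of the consecutive darts runs against its arrow, the arrows share a head or a
    -- tail.
    have key' : ∀ a b : Arrow F, a ≠ b → (a.src = b.src ∨ a.tgt hF = b.tgt hF) →
        form (a.operator hF) (b.operator hF) = 1 := by
      intro a b hab h
      have h₃ : a.src ≠ b.tgt hF := by
        rcases h with h | h
        · rw [h]; exact hn b
        · rw [← h]; exact hn a
      have h₄ : a.tgt hF ≠ b.src := by
        rcases h with h | h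
        · rw [← h]; exact (hn a).symm
        · rw [h]; exact (hn b).symm
      rw [form_operator, if_neg h₃, if_neg h₄, if_pos ⟨hab, h⟩]
      rfl
    obtain ⟨a, rfl | rfl⟩ := exists_dart hF d <;> obtain ⟨b, rfl | rfl⟩ := exists_dart hF d' <;>
      simp only [dartOperator_dart, dartOperator_dart_symm, form_mul_left, form_mul_right,
        form_scalar_left, form_scalar_right, zero_add]
    · exact key a b h₁ h₂
    · exact key' a b (fun h => h₂ (by rw [h]; rfl)) (.inr h₁)
    · exact key' a b (fun h => h₂ (by rw [h]; rfl)) (.inl h₁)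
    · rw [form_comm]
      exact key b a h₁.symm h₂.symm

end Arrow
end FermionEncoding

/-! ### Square cycles and existence of the encoding -/

namespace FermionEncoding

open PauliGroup

variable {F : Finset (Finset Vertex)}

theorem mul_eq_scalar_of_op_eq {Q : Type} [Fintype Q] {a b : PauliGroup Q} (h : a.op = b.op) :
    a * b = scalar Q (a.phase + b.phase) := by
  apply PauliGroup.ext
  · simp only [mul_phase, h, Pauli.mulPhase_self, Finset.sum_const_zero, scalar, add_zero]
  · funext q
    rw [mul_op, h]
    exact Pauli.mulOp_self _

-- At the common head `Y` cancels; what remains, `X` on both tails and `Z` on the square, is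
-- symmetric in `u` and `u'`. So the two halves of a square walk have the same string.
open Classical in
theorem edgeString_mul_op {u u' w : LatticeVertex F} (h : u ≠ u') (hw : u ≠ w) (hw' : u' ≠ w)
    (hs : squareOf u.1 = squareOf u'.1) (s s' : ZMod 4) :
    ((⟨s, edgeString F u w .X⟩ : PauliGroup (Qubit F)) * ⟨s', edgeString F u' w .Y⟩).op =
      Sum.elim (fun v => if v = u ∨ v = u' then .X else .I)
        fun f => if f.1.1 = squareOf u.1 then .Z else .I := by
  funext q
  rw [mul_op]
  rcases q with v | f
  · simp only [edgeString, Sum.elim_inl]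
    by_cases h1 : v = u
    · subst h1
      simp [h, hw, Pauli.mulOp]
    · by_cases h2 : v = u'
      · subst h2
        simp [h1, hw', Pauli.mulOp]
      · simp only [h1, h2, if_false, or_self]
        exact Pauli.mulOp_self _
  · simp only [edgeString_inr, Sum.elim_inr, ← hs]
    split_ifs <;> rfl

/-- The extra `1` is the `i` of `XY = iZ` on the square qubit; no vertex contributes. -/
theorem edgeString_mul_phase {u u' w : LatticeVertex F} (h : u ≠ u') (hw : u ≠ w) (hw' : u' ≠ w)
    (hs : squareOf u.1 = squareOf u'.1) (hu : squareOf u.1 ∈ F) (s s' : ZMod 4) :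
    ((⟨s, edgeString F u w .X⟩ : PauliGroup (Qubit F)) * ⟨s', edgeString F u' w .Y⟩).phase =
      s + s' + 1 := by
  rw [mul_phase, Finset.sum_eq_single (.inr ⟨⟨_, hu⟩, isSquare_squareOf _⟩)]
  · simp only [edgeString_inr, ← hs, if_true]
    rfl
  · rintro (v | f) _ hq
    · simp only [edgeString]
      by_cases h1 : v = u
      · subst h1
        simp [h, hw]
      · by_cases h2 : v = u'
        · subst h2
          simp [h1, hw']
        · simp only [h1, h2, if_false]
          exact Pauli.mulPhase_self _
    · have hf : f.1.1 ≠ squareOf u.1 := fun h' => hq (by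
        rw [Sum.inr.injEq]; exact Subtype.ext (Subtype.ext h'))
      simp only [edgeString_inr, if_neg hf, Pauli.mulPhase_I_left]
  · simp

namespace Arrow

variable (hF : IsLattice F)

/-- The closed walk around a square. -/
def squareWalk (u : HexSource F) : (latticeGraph F).Walk u.1 u.1 :=
  .cons (v := tgt hF (.inr u)) (adj hF (.inr u))
    (.cons (v := u.partner.1) (tgt_inl_partner hF u ▸ (adj hF (.inl u.partner.1)).symm)
      (.cons (v := tgt hF (.inl u.1)) (tgt_inr_partner hF u ▸ adj hF (.inr u.partner))
        (.cons (adj hF (.inl u.1)).symm .nil)))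

theorem darts_squareWalk (u : HexSource F) : (squareWalk hF u).darts =
    [dart hF (.inr u), (dart hF (.inl u.partner.1)).symm, dart hF (.inr u.partner),
      (dart hF (.inl u.1)).symm] := by
  refine congrArg₂ List.cons rfl (congrArg₂ List.cons ?_ (congrArg₂ List.cons ?_ rfl))
  · exact SimpleGraph.Dart.ext _ _ (Prod.ext (tgt_inl_partner hF u).symm rfl)
  · exact SimpleGraph.Dart.ext _ _ (Prod.ext rfl (tgt_inr_partner hF u).symm)

theorem chain_squareWalk (u : HexSource F) :
    (orientation hF).chain (squareWalk hF u) = squareCycle u := by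
  have h : ∀ a, (orientation hF).arrow (dart hF a) = a := (orientation hF).arrow_dart
  simp only [Orientation.chain, darts_squareWalk, List.map_cons, List.map_nil, List.sum_cons,
    List.sum_nil, Orientation.arrow_symm, h, squareCycle, add_zero]
  abel

/-- The halves have equal strings and each carries an `i`; the resulting `i² = -1` is cancelled by
the one minus sign in the square. -/
theorem operator_mul_squareWalk (u : HexSource F) :
    (operator hF (.inr u) * operator hF (.inl u.partner.1)) *
      (operator hF (.inr u.partner) * operator hF (.inl u.1)) = 1 := by
  have hn := fun a : Arrow F => (adj hF a).ne
  have h : u.1 ≠ u.partner.1 := fun h => u.partner_ne (Subtype.ext h.symm)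
  have hs : squareOf u.1.1 = squareOf u.partner.1.1 := (squareOf_partner _).symm
  have h1 : operator hF (.inl u.partner.1) =
      ⟨0, edgeString F u.partner.1 (tgt hF (.inr u)) .Y⟩ := by
    rw [← tgt_inl_partner]; rfl
  have h2 : operator hF (.inl u.1) = ⟨0, edgeString F u.1 (tgt hF (.inr u.partner)) .Y⟩ := by
    rw [tgt_inr_partner]; rfl
  have h3 : u.partner.1 ≠ tgt hF (.inr u) := tgt_inl_partner hF u ▸ hn (.inl u.partner.1)
  have h4 : u.1 ≠ tgt hF (.inr u.partner) := tgt_inr_partner hF u ▸ hn (.inl u.1)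
  have h5 : operator hF (.inr u) = ⟨sign (.inr u), edgeString F u.1 (tgt hF (.inr u)) .X⟩ := rfl
  have h6 : operator hF (.inr u.partner) =
    ⟨sign (.inr u.partner), edgeString F u.partner.1 (tgt hF (.inr u.partner)) .X⟩ := rfl
  rw [h1, h2, h5, h6, mul_eq_scalar_of_op_eq]
  · rw [edgeString_mul_phase h (hn (.inr u)) h3 hs u.2,
      edgeString_mul_phase h.symm (hn (.inr u.partner)) h4 hs.symm u.partner.2]
    have h7 : sign (.inr u) + 0 + 1 + (sign (.inr u.partner) + 0 + 1) =
        sign (.inr u) + sign (.inr u.partner) + 2 := by ring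
    rw [h7, sign_partner]
    rfl
  · rw [edgeString_mul_op h (hn (.inr u)) h3 hs,
      edgeString_mul_op h.symm (hn (.inr u.partner)) h4 hs.symm]
    simp only [or_comm, hs]

/-- The prefactor is `i⁴ = 1`, and the signs of the two sides traversed backwards cancel. -/
theorem map_cycleElement_squareWalk {σ : MG (latticeGraph F) →* PauliGroup (Qubit F)}
    (hedge : ∀ d, σ (MG.gen _ (.edge d)) = dartOperator hF d) (u : HexSource F) :
    σ (cycleElement _ (squareWalk hF u)) = 1 := by
  have hlen : ((squareWalk hF u).length : ZMod 4) = 0 := by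
    rw [← SimpleGraph.Walk.length_darts, darts_squareWalk]
    exact ZMod.natCast_self 4
  rw [cycleElement, hlen, gen_phase_zero, one_mul, darts_squareWalk]
  simp only [List.map_cons, List.map_nil, List.prod_cons, List.prod_nil, mul_one, map_mul, hedge,
    dartOperator_dart, dartOperator_dart_symm]
  have hcomm : ∀ x y : PauliGroup (Qubit F), x * (scalar _ 2 * y) = scalar _ 2 * (x * y) :=
    fun x y => by rw [← mul_assoc, ← scalar_comm, mul_assoc]
  calc _ = (scalar _ 2 * scalar _ 2) *
        ((operator hF (.inr u) * operator hF (.inl u.partner.1)) *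
          (operator hF (.inr u.partner) * operator hF (.inl u.1))) := by
          simp only [mul_assoc, hcomm]
    _ = 1 := by rw [operator_mul_squareWalk, mul_one, scalar_mul_scalar]; rfl

theorem exists_cycle_of_squareChain {σ : MG (latticeGraph F) →* PauliGroup (Qubit F)}
    (hedge : ∀ d, σ (MG.gen _ (.edge d)) = dartOperator hF d)
    (s : {f : F // IsSquare f.1} → ZMod 2) : ∃ c ∈ cycleGroup (latticeGraph F), σ c = 1 ∧
      QuotientGroup.mk c = (orientation hF).chainClass (squareChain F s) := by
  induction s using Pi.single_induction with
  | zero => exact ⟨1, one_mem _, map_one _, by rw [map_zero, Orientation.chainClass_zero]; rfl⟩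
  | add s t hs ht =>
    obtain ⟨c, hc, h1, h2⟩ := hs
    obtain ⟨c', hc', h1', h2'⟩ := ht
    refine ⟨c * c', mul_mem hc hc', by rw [map_mul, h1, h1', mul_one], ?_⟩
    rw [map_add, Orientation.chainClass_add, ← h2, ← h2', QuotientGroup.mk_mul]
  | single f r =>
    obtain ⟨u, rfl⟩ := HexSource.square_surjective f
    rcases (by decide : ∀ r : ZMod 2, r = 0 ∨ r = 1) r with rfl | rfl
    · exact ⟨1, one_mem _, map_one _,
        by rw [Pi.single_zero, map_zero, Orientation.chainClass_zero]; rfl⟩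
    · refine ⟨cycleElement _ (squareWalk hF u), Subgroup.subset_closure ⟨_, _, rfl⟩,
        map_cycleElement_squareWalk hF hedge u, ?_⟩
      rw [Orientation.mk_cycleElement (orientation hF), chain_squareWalk, squareChain_single]

include hF in
theorem exists_isLatticeEncoding :
    ∃ σ : MG (latticeGraph F) →* PauliGroup (Qubit F), IsLatticeEncoding F σ := by
  obtain ⟨σ, hphase, hvertex, hedge⟩ := exists_string_representation hF
  have hstring : IsStringRepresentation hF σ :=
    ⟨hphase, fun a => by rw [hedge, dartOperator_dart]; rfl⟩
  have hsign : ∀ a : Arrow F, a.sign = 0 ∨ a.sign = 2 := fun a =>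
    (by decide : ∀ c : ZMod 4, 2 * c = 0 → c = 0 ∨ c = 2) _ a.two_mul_sign
  have hdart : ∀ (d : (latticeGraph F).Dart) (a : Arrow F), d.fst = a.src → d.snd = a.tgt hF →
      σ (MG.gen _ (.edge d)) = ⟨a.sign, edgeString F d.fst d.snd a.pauli⟩ := by
    intro d a h h'
    obtain rfl : d = a.dart hF := SimpleGraph.Dart.ext _ _ (Prod.ext h h')
    rw [hedge, dartOperator_dart]
    rfl
  refine ⟨σ, ⟨hphase, neg_one_notMem_stabilizerGroup fun c hc hbits => ?_⟩, hvertex, ?_, ?_⟩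
  -- One chain records both the class of `c` modulo signs and the bits of `σ c`; when the bits
  -- vanish, it is a sum of squares.
  · have key : ∀ c ∈ cycleGroup (latticeGraph F), ∃ x,
        QuotientGroup.mk c = (orientation hF).chainClass x ∧
          (bits (σ c)).toAdd = stringMap hF x := by
      intro c hc
      induction hc using Subgroup.closure_induction with
      | mem c hc =>
        obtain ⟨v, p, rfl⟩ := hc
        exact ⟨_, Orientation.mk_cycleElement _ p, hstring.bits_cycleElement p⟩
      | one => exact ⟨0, by rw [Orientation.chainClass_zero]; rfl, by simp⟩
      | mul a b _ _ ha hb =>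
        obtain ⟨x, hx, hx'⟩ := ha
        obtain ⟨y, hy, hy'⟩ := hb
        exact ⟨x + y, by rw [Orientation.chainClass_add, ← hx, ← hy, QuotientGroup.mk_mul],
          by rw [map_mul, map_mul, toAdd_mul, hx', hy', map_add]⟩
      | inv a _ ha =>
        obtain ⟨x, hx, hx'⟩ := ha
        exact ⟨x, by rw [QuotientGroup.mk_inv, hx, Orientation.chainClass_inv],
          by rw [map_inv, map_inv, toAdd_inv, hx', ZModModule.neg_eq_self]⟩
    obtain ⟨x, hx, hx'⟩ := key c hc
    have hker : x ∈ LinearMap.ker (stringMap hF) := by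
      rw [LinearMap.mem_ker, ← hx', hbits]; rfl
    rw [ker_stringMap] at hker
    obtain ⟨s, rfl⟩ := hker
    rw [hx]
    exact exists_cycle_of_squareChain hF hedge s
  · intro d hd
    have hu : squareOf d.fst.1 ∈ F := by
      obtain ⟨-, f, hf, hu, hw⟩ := d.adj
      exact hF.squareOf_mem_of_hexNext hf hu (hd ▸ hw)
    exact ⟨_, hsign _, hdart d (.inr ⟨d.fst, hu⟩) rfl (Subtype.ext hd)⟩
  · intro d hd
    exact ⟨_, hsign _, hdart d (.inl d.fst) rfl (Subtype.ext hd)⟩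

end Arrow

end FermionEncoding

theorem mainTheorem8 (F : Finset (Finset Vertex)) (hface : ∀ f ∈ F, IsFace f)
    (hconn : (latticeGraph F).Connected) (hholes : NoHoles F)
    (hsurr : HexagonsSurrounded F) (hmade : MadeOfHexagons F) :
    (∃ σ : MG (latticeGraph F) →* PauliGroup (Qubit F), IsLatticeEncoding F σ) ∧
      ∀ σ : MG (latticeGraph F) →* PauliGroup (Qubit F),
        IsLatticeEncoding F σ → disparity σ = -1 := by
  have hF : IsLattice F := ⟨hface, hsurr, hmade⟩
  exact ⟨Arrow.exists_isLatticeEncoding hF, fun σ hσ => hσ.disparity_eq hF hconn⟩
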